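/- Let $f$ be an orientation-preserving $C^2$ diffeomorphism of a closed interval $[a,b]$, $a<b$, different from the identity, all of whose fixed points are parabolic (i.e. $Df(x)=1$ whenever $f(x)=x$). Put $$\Gamma^n_+(f)=\sup_{x\in[a,b]}Df^n(x),\qquad \Gamma^n(f)=\sup_{x\in[a,b]}\max\{Df^n(x),Df^{-n}(x)\}.$$ A component of $f$ is a nondegenerate closed subinterval $I=[c,d]\subseteq[a,b]$ with $f(c)=c$, $f(d)=d$ and no fixed point of $f$ in its interior; $\mathcal C(f)$ denotes the set of components. Then: 1. Each $I\in\mathcal C(f)$ has exactly one topologically repelling endpoint $r_I$ (the endpoint from which $f$ moves all interior points of $I$ away). There is a unique $C^1$ vector field $X_I$ on the half-closed interval $I^{\mathrm o}\cup\{r_I\}$ whose time-$1$ map is the restriction of $f$ (the Szekeres vector field), and it extends continuously to $I$. 2. The sequence $\Gamma^n_+(f)/n^2$ converges to a finite limit, and $$\lim_{n\to\infty}\frac{\Gamma^n_+(f)}{n^2}=\sup_{I\in\mathcal C(f)}\Big[\tfrac12\,|D^2f(r_I)|\cdot\max_{y\in I}|X_I(y)|\Big].$$ This limit is positive if $D^2f(r_I)\neq0$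 for some $I\in\mathcal C(f)$, and it is $0$ if $D^2f(r_I)=0$ for all $I\in\mathcal C(f)$. 3. The sequence $\Gamma^n(f)/n^2$ converges to a finite limit (in particular it is bounded), and this limit is $0$ if $D^2f(x)=0$ at every fixed point $x$ of $f$. -/

import Mathlib

open Set Filter Topology

namespace IntervalDiffeo

/-- The inverse of `f : [a,b] → [a,b]` (its values off `[a,b]` are irrelevant). -/
noncomputable def inverse (a b : ℝ) (f : ℝ → ℝ) : ℝ → ℝ :=
  Function.invFunOn f (Icc a b)

/-- `f` restricts to an orientation-preserving `C²` diffeomorphism of `[a,b]`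
(with one-sided derivatives at the endpoints). -/
structure IsC2Diffeo (a b : ℝ) (f : ℝ → ℝ) : Prop where
  bijOn : BijOn f (Icc a b) (Icc a b)
  monotoneOn : MonotoneOn f (Icc a b)
  contDiffOn : ContDiffOn ℝ 2 f (Icc a b)
  contDiffOn_inverse : ContDiffOn ℝ 2 (inverse a b f) (Icc a b)

/-- All the fixed points of `f` in `[a,b]` are parabolic, that is, the derivative there is `1`. -/
def OnlyParabolicFixedPoints (a b : ℝ) (f : ℝ → ℝ) : Prop :=
  ∀ x ∈ Icc a b, f x = x → derivWithin f (Icc a b) x = 1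

/-- `Γ₊ⁿ(f)`, the supremum over `x ∈ [a,b]` of the derivative of the `n`-th iterate of `f`. -/
noncomputable def gammaPlus (a b : ℝ) (f : ℝ → ℝ) (n : ℕ) : ℝ :=
  sSup ((fun x => derivWithin (f^[n]) (Icc a b) x) '' Icc a b)

/-- `Γⁿ(f)`, the supremum over `x ∈ [a,b]` of the maximum of the derivatives of `fⁿ` and `f⁻ⁿ`. -/
noncomputable def gamma (a b : ℝ) (f : ℝ → ℝ) (n : ℕ) : ℝ :=
  sSup ((fun x => max (derivWithin (f^[n]) (Icc a b) x)
    (derivWithin ((inverse a b f)^[n]) (Icc a b) x)) '' Icc a b)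

/-- The second derivative of `f` at a point of `[a,b]` (one-sided at the endpoints). -/
noncomputable def secondDeriv (a b : ℝ) (f : ℝ → ℝ) (x : ℝ) : ℝ :=
  iteratedDerivWithin 2 f (Icc a b) x

/-- `[c,d]` is a component of `f`: a nondegenerate subinterval of `[a,b]` fixed by `f`
(as `f` is increasing: whose endpoints are fixed) without fixed point in its interior. -/
structure IsComponent (a b : ℝ) (f : ℝ → ℝ) (c d : ℝ) : Prop where
  lt : c < d
  subset : Icc c d ⊆ Icc a b
  fixed_left : f c = c
  fixed_right : f d = d
  ne_of_mem_interior : ∀ x ∈ Ioo c d, f x ≠ x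

/-- `r` is an endpoint of `[c,d]` that is topologically repelling for `f` on `[c,d]`:
`f` moves every interior point away from `r`. -/
def IsRepellingEndpoint (f : ℝ → ℝ) (c d r : ℝ) : Prop :=
  (r = c ∨ r = d) ∧ ∀ x ∈ Ioo c d, |x - r| < |f x - r|

/-- The half-closed interval obtained by adding the endpoint `r` to the interior of `[c,d]`. -/
def halfClosed (c d r : ℝ) : Set ℝ :=
  Ioo c d ∪ {r}

/-- `f` is the time-`1` map of the vector field `X` on `S`: from each `x ∈ S` starts an integral
curve of `X` that stays in `S` and is at `f x` at time `1`. -/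
def IsTimeOneMap (X : ℝ → ℝ) (S : Set ℝ) (f : ℝ → ℝ) : Prop :=
  ∀ x ∈ S, ∃ φ : ℝ → ℝ, φ 0 = x ∧ φ 1 = f x ∧ (∀ t ∈ Icc (0 : ℝ) 1, φ t ∈ S) ∧
    IsIntegralCurveOn φ (fun _ => X) (Icc (0 : ℝ) 1)

/-- `X` is a Szekeres vector field of `f` on the component `[c,d]` with repelling endpoint `r`:
it is `C¹` on the half-closed interval and its time-`1` map there is `f`. -/
structure IsSzekeresField (f : ℝ → ℝ) (c d r : ℝ) (X : ℝ → ℝ) : Prop where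
  contDiffOn : ContDiffOn ℝ 1 X (halfClosed c d r)
  isTimeOneMap : IsTimeOneMap X (halfClosed c d r) f

/-- The set of the numbers `(1/2) |D²f(r_I)| max_{y ∈ I} |X_I(y)|`, where `I` runs over the
components of `f`, and the Szekeres vector field `X_I` is extended continuously to `I`. -/
def growthValues (a b : ℝ) (f : ℝ → ℝ) : Set ℝ :=
  {v | ∃ (c d r : ℝ) (X : ℝ → ℝ) (M : ℝ), IsComponent a b f c d ∧ IsRepellingEndpoint f c d r ∧
    IsSzekeresField f c d r X ∧ ContinuousOn X (Icc c d) ∧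
    IsGreatest ((fun y => |X y|) '' Icc c d) M ∧
    v = 1 / 2 * |secondDeriv a b f r| * M}

end IntervalDiffeo

/-!
On a component take the inverse `g` of `f` as a contraction towards the repelling endpoint `r`.
Its Szekeres field satisfies `X ∘ g = g' * X`, hence `(gⁿ)' = (X ∘ gⁿ) / X`.

If `g` has displacement `δ x = x - g x` and `κ = |D²f(r)| / 2`, then `δ` and `|X|` are both
`κ x² + o(x²)` at `r`, and `(δ (gⁿ x))^{-1/2} ≈ √κ n`; thus `1 / |X (gⁿ x)|` grows like `κ n²` and
`(fⁿ)'(gⁿ x) = |X x| / |X (gⁿ x)|` like `κ n² |X x|`.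

A bound for `1 / (gⁿ)'` in terms of `n` and the displacement alone, uniform over all components,
shows that points of small displacement do not contribute to the limit of the suprema; the remaining
points form a compact set without fixed points, on which the pointwise asymptotics are uniform.
-/

namespace IntervalDiffeo

theorem exists_sub_eq_deriv_mul {φ φ' : ℝ → ℝ} {s t : ℝ} (hst : s < t)
    (hc : ContinuousOn φ (Icc s t)) (hd : ∀ x ∈ Ioo s t, HasDerivAt φ (φ' x) x) :
    ∃ ξ ∈ Ioo s t, φ t - φ s = φ' ξ * (t - s) := by
  obtain ⟨ξ, hξ, hslope⟩ := exists_hasDerivAt_eq_slope φ φ' hst hc hd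
  exact ⟨ξ, hξ, by rw [hslope, div_mul_cancel₀ _ (sub_pos.2 hst).ne']⟩

theorem exists_hasDerivAt_of_continuousOn_Ioo {p q : ℝ} {φ : ℝ → ℝ}
    (hφ : ContinuousOn φ (Ioo p q)) : ∃ Φ : ℝ → ℝ, ∀ x ∈ Ioo p q, HasDerivAt Φ (φ x) x := by
  refine ⟨fun x => ∫ t in ((p + q) / 2)..x, φ t, fun x hx => ?_⟩
  have hmid : (p + q) / 2 ∈ Ioo p q := ⟨by linarith [hx.1, hx.2], by linarith [hx.1, hx.2]⟩
  have hsub : uIcc ((p + q) / 2) x ⊆ Ioo p q := ordConnected_Ioo.uIcc_subset hmid hx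
  exact intervalIntegral.integral_hasDerivAt_right ((hφ.mono hsub).intervalIntegrable)
    (hφ.stronglyMeasurableAtFilter isOpen_Ioo x hx) (hφ.continuousAt (isOpen_Ioo.mem_nhds hx))

/-- `T` is a time function of the vector field `Y` on `s`: it grows at unit speed along the
integral curves of `Y`. -/
def IsTimeFunctionOn (T Y : ℝ → ℝ) (s : Set ℝ) : Prop :=
  ∀ x ∈ s, HasDerivAt T (Y x)⁻¹ x

theorem exists_isTimeFunctionOn {p q : ℝ} {Y : ℝ → ℝ} (hY : ContinuousOn Y (Ioo p q))
    (hY₀ : ∀ x ∈ Ioo p q, Y x ≠ 0) : ∃ T, IsTimeFunctionOn T Y (Ioo p q) :=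
  exists_hasDerivAt_of_continuousOn_Ioo (hY.inv₀ hY₀)

namespace IsTimeFunctionOn

variable {T Y : ℝ → ℝ} {s : Set ℝ} {p q : ℝ}

theorem continuousOn (hT : IsTimeFunctionOn T Y s) : ContinuousOn T s :=
  fun x hx => (hT x hx).continuousAt.continuousWithinAt

theorem strictMonoOn (hT : IsTimeFunctionOn T Y (Ioo p q)) (hY : ∀ x ∈ Ioo p q, 0 < Y x) :
    StrictMonoOn T (Ioo p q) :=
  strictMonoOn_of_deriv_pos (convex_Ioo p q) hT.continuousOn fun x hx => by
    rw [interior_Ioo] at hx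
    rw [(hT x hx).deriv]
    exact inv_pos.2 (hY x hx)

theorem hasDerivAt_invFunOn (hT : IsTimeFunctionOn T Y (Ioo p q))
    (hYc : ContinuousOn Y (Ioo p q)) (hY : ∀ x ∈ Ioo p q, 0 < Y x) {x : ℝ} (hx : x ∈ Ioo p q) :
    HasDerivAt (Function.invFunOn T (Ioo p q)) (Y x) (T x) := by
  have hnhds : Ioo p q ∈ 𝓝 x := isOpen_Ioo.mem_nhds hx
  have hstrict : HasStrictDerivAt T (Y x)⁻¹ x :=
    hasStrictDerivAt_of_hasDerivAt_of_continuousAt (by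
      filter_upwards [hnhds] with y hy using hT y hy)
      ((hYc.continuousAt hnhds).inv₀ (hY x hx).ne')
  have hinv := hstrict.to_local_left_inverse (inv_ne_zero (hY x hx).ne')
    (g := Function.invFunOn T (Ioo p q)) (by
      filter_upwards [hnhds] with y hy
      exact (hT.strictMonoOn hY).injOn.leftInvOn_invFunOn hy)
  rw [inv_inv] at hinv
  exact hinv.hasDerivAt

/-- The integral curve through `x` is `t ↦ T⁻¹ (T x + t)`. -/
theorem isTimeOneMap {F : ℝ → ℝ} (hT : IsTimeFunctionOn T Y (Ioo p q))
    (hYc : ContinuousOn Y (Ioo p q)) (hY : ∀ x ∈ Ioo p q, 0 < Y x) (hYp : Y p = 0)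
    (hFp : F p = p) (hF : MapsTo F (Ioo p q) (Ioo p q))
    (hTF : ∀ x ∈ Ioo p q, T (F x) - T x = 1) : IsTimeOneMap Y (Ico p q) F := by
  intro x hx
  rcases hx.1.eq_or_lt with rfl | hpx
  · refine ⟨fun _ => p, rfl, hFp.symm, fun _ _ => hx, fun t _ => ?_⟩
    simpa only [hYp] using hasDerivWithinAt_const t (Icc 0 1) p
  replace hx : x ∈ Ioo p q := ⟨hpx, hx.2⟩
  have hinv := (hT.strictMonoOn hY).injOn.leftInvOn_invFunOn
  have hmem : ∀ t ∈ Icc (0 : ℝ) 1, ∃ y ∈ Ioo p q, T y = T x + t := by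
    intro t ht
    have hsub : uIcc x (F x) ⊆ Ioo p q := ordConnected_Ioo.uIcc_subset hx (hF hx)
    obtain ⟨y, hy, hTy⟩ := intermediate_value_uIcc (hT.continuousOn.mono hsub)
      (Icc_subset_uIcc (show T x + t ∈ Icc (T x) (T (F x)) from
        ⟨by linarith [ht.1], by linarith [ht.2, hTF x hx]⟩))
    exact ⟨y, hsub hy, hTy⟩
  refine ⟨fun t => Function.invFunOn T (Ioo p q) (T x + t), ?_, ?_, fun t ht => ?_, fun t ht => ?_⟩
  · simpa only [add_zero] using hinv hx
  · simpa only [← hTF x hx, add_sub_cancel] using hinv (hF hx)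
  · obtain ⟨y, hy, hTy⟩ := hmem t ht
    simpa only [← hTy, hinv hy] using Ioo_subset_Ico_self hy
  · obtain ⟨y, hy, hTy⟩ := hmem t ht
    have hd := hT.hasDerivAt_invFunOn hYc hY hy
    rw [hTy] at hd
    simpa only [← hTy, hinv hy] using (hd.comp_const_add (T x) t).hasDerivWithinAt

end IsTimeFunctionOn

namespace IsTimeOneMap

variable {Y F : ℝ → ℝ}

theorem eq_zero_of_isLeast {S : Set ℝ} {p : ℝ} (hY : IsTimeOneMap Y S F) (hp : IsLeast S p)
    (hF : F p = p) : Y p = 0 := by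
  obtain ⟨φ, hφ₀, hφ₁, hφS, hφ⟩ := hY p hp.1
  rw [hF] at hφ₁
  have hmin : ∀ t, φ t = p → IsLocalMinOn φ (Icc 0 1) t := fun t ht =>
    IsMinOn.localize fun s hs => by simpa only [mem_ofPred_eq, ht] using hp.2 (hφS s hs)
  apply le_antisymm
  · have hd := hφ 1 (by simp)
    rw [hφ₁] at hd
    have := (hmin 1 hφ₁).hasFDerivWithinAt_nonneg (y := -1) hd.hasFDerivWithinAt
      (mem_posTangentConeAt_of_segment_subset (by simp [segment_symm ℝ (1 : ℝ), segment_eq_Icc]))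
    simpa using this
  · have hd := hφ 0 (by simp)
    rw [hφ₀] at hd
    have := (hmin 0 hφ₀).hasFDerivWithinAt_nonneg (y := 1) hd.hasFDerivWithinAt
      (mem_posTangentConeAt_of_segment_subset (by simp [segment_eq_Icc]))
    simpa using this

theorem apply_eq_self_of_eq_zero {S : Set ℝ} {x : ℝ} (hY : IsTimeOneMap Y S F)
    (hC : ContDiffOn ℝ 1 Y S) (hx : x ∈ S) (hYx : Y x = 0) : F x = x := by
  obtain ⟨φ, hφ₀, hφ₁, hφS, hφ⟩ := hY x hx
  have hφc : ContinuousOn φ (Icc 0 1) := fun t ht => (hφ t ht).continuousWithinAt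
  obtain ⟨K, hK⟩ := (hC.mono (image_subset_iff.2 hφS)).exists_lipschitzOnWith one_ne_zero
    (isPreconnected_Icc.image φ hφc).ordConnected.convex (isCompact_Icc.image_of_continuousOn hφc)
  have hx' : x ∈ φ '' Icc 0 1 := ⟨0, by simp, hφ₀⟩
  have hconst := eq_zero_of_abs_deriv_le_mul_abs_self_of_eq_zero_right (f := fun t => φ t - x)
    (f' := fun t => Y (φ t)) (K := K) (hφc.sub continuousOn_const)
    (fun t ht => ((hφ t (Ico_subset_Icc_self ht)).sub_const x).mono_of_mem_nhdsWithin
      (Icc_mem_nhdsGE_of_mem ht)) (by simp [hφ₀])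
    (fun t ht => by
      have := hK.dist_le_mul _ (mem_image_of_mem φ (Ico_subset_Icc_self ht)) x hx'
      rwa [Real.dist_eq, Real.dist_eq, hYx, sub_zero] at this) 1 (by simp)
  rwa [hφ₁, sub_eq_zero] at hconst

variable {p q : ℝ} {x : ℝ}

theorem pos_of_lt_apply (hY : IsTimeOneMap Y (Ico p q) F) (hC : ContDiffOn ℝ 1 Y (Ico p q))
    (hFp : F p = p) (hF : ∀ x ∈ Ioo p q, x < F x) (hx : x ∈ Ioo p q) : 0 < Y x := by
  have hne : ∀ y ∈ Ioo p q, Y y ≠ 0 := fun y hy hYy =>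
    (hF y hy).ne' (hY.apply_eq_self_of_eq_zero hC (Ioo_subset_Ico_self hy) hYy)
  by_contra! hYx
  have hnonpos : ∀ y ∈ Ico p q, Y y ≤ 0 := by
    intro y hy
    rcases hy.1.eq_or_lt with rfl | hpy
    · exact (hY.eq_zero_of_isLeast ⟨hy, fun z hz => hz.1⟩ hFp).le
    by_contra! hYy
    obtain ⟨w, hw, hYw⟩ := isPreconnected_Ioo.intermediate_value hx ⟨hpy, hy.2⟩
      (hC.continuousOn.mono Ioo_subset_Ico_self) ⟨hYx, hYy.le⟩
    exact hne w hw hYw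
  obtain ⟨φ, hφ₀, hφ₁, hφS, hφ⟩ := hY x (Ioo_subset_Ico_self hx)
  obtain ⟨t, ht, hslope⟩ := exists_sub_eq_deriv_mul zero_lt_one
    (fun t ht => (hφ t ht).continuousWithinAt)
    (fun t ht => (hφ t (Ioo_subset_Icc_self ht)).hasDerivAt (Icc_mem_nhds ht.1 ht.2))
  rw [hφ₀, hφ₁] at hslope
  linarith [hnonpos _ (hφS t (Ioo_subset_Icc_self ht)), hF x hx]

theorem time_apply_sub_eq_one {T : ℝ → ℝ} (hY : IsTimeOneMap Y (Ico p q) F)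
    (hT : IsTimeFunctionOn T Y (Ioo p q)) (hY₀ : 0 ≤ Y p) (hpos : ∀ x ∈ Ioo p q, 0 < Y x)
    (hx : x ∈ Ioo p q) : T (F x) - T x = 1 := by
  obtain ⟨φ, hφ₀, hφ₁, hφS, hφ⟩ := hY x (Ioo_subset_Ico_self hx)
  have hφc : ContinuousOn φ (Icc 0 1) := fun t ht => (hφ t ht).continuousWithinAt
  have hd : ∀ t ∈ Ioo (0 : ℝ) 1, HasDerivAt φ (Y (φ t)) t := fun t ht =>
    (hφ t (Ioo_subset_Icc_self ht)).hasDerivAt (Icc_mem_nhds ht.1 ht.2)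
  have hmono : MonotoneOn φ (Icc 0 1) := by
    refine monotoneOn_of_deriv_nonneg (convex_Icc 0 1) hφc (fun t ht => ?_) (fun t ht => ?_) <;>
      rw [interior_Icc] at ht
    · exact (hd t ht).differentiableAt.differentiableWithinAt
    · rw [(hd t ht).deriv]
      rcases (hφS t (Ioo_subset_Icc_self ht)).1.eq_or_lt with h | h
      · rwa [← h]
      · exact (hpos _ ⟨h, (hφS t (Ioo_subset_Icc_self ht)).2⟩).le
  have hφI : ∀ t ∈ Icc (0 : ℝ) 1, φ t ∈ Ioo p q := fun t ht =>
    ⟨(hφ₀ ▸ hx.1).trans_le (hmono (by simp) ht ht.1), (hφS t ht).2⟩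
  obtain ⟨t, -, hslope⟩ := exists_sub_eq_deriv_mul (φ := fun t => T (φ t)) (φ' := fun _ => 1)
    zero_lt_one (hT.continuousOn.comp hφc hφI) (fun t ht => by
      have hp := hφI t (Ioo_subset_Icc_self ht)
      have := (hT _ hp).comp t (hd t ht)
      rwa [inv_mul_cancel₀ (hpos _ hp).ne'] at this)
  simpa only [hφ₀, hφ₁, sub_zero, mul_one] using hslope

end IsTimeOneMap

/-- The displacement of `x` under a map `g` that moves points to the left. -/
def disp (g : ℝ → ℝ) (x : ℝ) : ℝ := x - g x

/-- The derivative of `g^[n]` at `x` as given by the chain rule, where `g'` is the derivative of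
`g`. -/
noncomputable def iterDeriv (g g' : ℝ → ℝ) (n : ℕ) (x : ℝ) : ℝ :=
  ∏ i ∈ Finset.range n, g' (g^[i] x)

theorem iterDeriv_zero (g g' : ℝ → ℝ) (x : ℝ) : iterDeriv g g' 0 x = 1 :=
  Finset.prod_range_zero _

theorem iterDeriv_succ (g g' : ℝ → ℝ) (n : ℕ) (x : ℝ) :
    iterDeriv g g' (n + 1) x = iterDeriv g g' n x * g' (g^[n] x) :=
  Finset.prod_range_succ _ _

/-- `g` is an increasing continuous self-map of `[0, L]` that fixes the endpoints and moves all
interior points towards `0`. -/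
structure IntervalContraction (L : ℝ) (g : ℝ → ℝ) : Prop where
  pos : 0 < L
  map_zero : g 0 = 0
  map_right : g L = L
  lt_self : ∀ x ∈ Ioo 0 L, g x < x
  continuousOn : ContinuousOn g (Icc 0 L)
  strictMonoOn : StrictMonoOn g (Icc 0 L)

namespace IntervalContraction

variable {L x y : ℝ} {g : ℝ → ℝ}

theorem mapsTo (h : IntervalContraction L g) : MapsTo g (Ioo 0 L) (Ioo 0 L) := fun x hx => by
  have hgx := h.strictMonoOn (left_mem_Icc.2 h.pos.le) (Ioo_subset_Icc_self hx) hx.1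
  exact ⟨h.map_zero ▸ hgx, (h.lt_self x hx).trans hx.2⟩

theorem iterate_mem (h : IntervalContraction L g) (hx : x ∈ Ioo 0 L) (n : ℕ) :
    g^[n] x ∈ Ioo 0 L :=
  h.mapsTo.iterate n hx

theorem antitone_iterate (h : IntervalContraction L g) (hx : x ∈ Ioo 0 L) :
    Antitone fun n => g^[n] x :=
  antitone_nat_of_succ_le fun n => by
    rw [Function.iterate_succ_apply']
    exact (h.lt_self _ (h.iterate_mem hx n)).le

theorem iterate_le_self (h : IntervalContraction L g) (hx : x ∈ Ioo 0 L) (n : ℕ) :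
    g^[n] x ≤ x :=
  h.antitone_iterate hx (Nat.zero_le n)

theorem iterate_lt_iterate (h : IntervalContraction L g) (hx : x ∈ Ioo 0 L) (hy : y ∈ Ioo 0 L)
    (hxy : x < y) (n : ℕ) : g^[n] x < g^[n] y := by
  induction n with
  | zero => exact hxy
  | succ n ih =>
    rw [Function.iterate_succ_apply', Function.iterate_succ_apply']
    exact h.strictMonoOn (Ioo_subset_Icc_self (h.iterate_mem hx n))
      (Ioo_subset_Icc_self (h.iterate_mem hy n)) ih

theorem tendsto_iterate (h : IntervalContraction L g) (hx : x ∈ Ioo 0 L) :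
    Tendsto (fun n => g^[n] x) atTop (𝓝 0) := by
  have hbdd : BddBelow (range fun n => g^[n] x) :=
    ⟨0, forall_mem_range.2 fun n => (h.iterate_mem hx n).1.le⟩
  have hlim := tendsto_atTop_ciInf (h.antitone_iterate hx) hbdd
  set l := ⨅ n, g^[n] x
  have hl₀ : 0 ≤ l := ge_of_tendsto' hlim fun n => (h.iterate_mem hx n).1.le
  rcases hl₀.eq_or_lt with hl₀ | hl₀
  · rwa [← hl₀] at hlim
  have hl : l ∈ Ioo 0 L :=
    ⟨hl₀, (le_of_tendsto' hlim fun n => h.iterate_le_self hx n).trans_lt hx.2⟩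
  have hfix := isFixedPt_of_tendsto_iterate hlim
    (h.continuousOn.continuousAt (Icc_mem_nhds hl.1 hl.2))
  exact absurd hfix (h.lt_self l hl).ne

theorem tendsto_iterate_nhdsGT (h : IntervalContraction L g) (hx : x ∈ Ioo 0 L) :
    Tendsto (fun n => g^[n] x) atTop (𝓝[>] 0) :=
  tendsto_nhdsWithin_iff.2
    ⟨h.tendsto_iterate hx, Eventually.of_forall fun n => (h.iterate_mem hx n).1⟩

theorem apply_iterate_eq_iterDeriv_mul {D g' : ℝ → ℝ} (h : IntervalContraction L g)
    (hD : ∀ y ∈ Ioo 0 L, D (g y) = g' y * D y) (hx : x ∈ Ioo 0 L) (n : ℕ) :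
    D (g^[n] x) = iterDeriv g g' n x * D x := by
  induction n with
  | zero => rw [iterDeriv_zero, one_mul, Function.iterate_zero_apply]
  | succ n ih =>
    rw [Function.iterate_succ_apply', hD _ (h.iterate_mem hx n), ih, iterDeriv_succ]
    ring

theorem disp_pos (h : IntervalContraction L g) (hx : x ∈ Ioo 0 L) : 0 < disp g x :=
  sub_pos.2 (h.lt_self x hx)

theorem disp_zero (h : IntervalContraction L g) : disp g 0 = 0 := by
  rw [disp, h.map_zero, sub_zero]

theorem disp_right (h : IntervalContraction L g) : disp g L = 0 := by
  rw [disp, h.map_right, sub_self]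

theorem disp_nonneg (h : IntervalContraction L g) (hx : x ∈ Icc 0 L) : 0 ≤ disp g x := by
  rcases eq_endpoints_or_mem_Ioo_of_mem_Icc hx with rfl | rfl | hx
  · exact h.disp_zero.ge
  · exact h.disp_right.ge
  · exact (h.disp_pos hx).le

theorem disp_le_self (h : IntervalContraction L g) (hx : x ∈ Ioo 0 L) : disp g x ≤ x :=
  sub_le_self x (h.mapsTo hx).1.le

theorem continuousOn_disp (h : IntervalContraction L g) : ContinuousOn (disp g) (Icc 0 L) :=
  continuousOn_id.sub h.continuousOn

theorem tendsto_sub_div_disp_iterate {D D' : ℝ → ℝ} (h : IntervalContraction L g)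
    (hD : ∀ y ∈ Ioo 0 L, HasDerivAt D (D' y) y) (hD' : Tendsto D' (𝓝[>] 0) (𝓝 0))
    (hx : x ∈ Ioo 0 L) {ξ : ℕ → ℝ} (hξ : ∀ n, ξ n ∈ Ioo (g (g^[n] x)) (g^[n] x)) :
    Tendsto (fun n => (D (g^[n] x) - D (ξ n)) / disp g (g^[n] x)) atTop (𝓝 0) := by
  have hmem := h.iterate_mem hx
  have hξ₀ : ∀ n, 0 < ξ n := fun n => (h.mapsTo (hmem n)).1.trans (hξ n).1
  have hmvt : ∀ n, ∃ ζ ∈ Ioo (ξ n) (g^[n] x), D (g^[n] x) - D (ξ n) = D' ζ * (g^[n] x - ξ n) :=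
    fun n => by
      have hsub : Icc (ξ n) (g^[n] x) ⊆ Ioo 0 L := fun y hy =>
        ⟨(hξ₀ n).trans_le hy.1, hy.2.trans_lt (hmem n).2⟩
      exact exists_sub_eq_deriv_mul (hξ n).2
        (fun y hy => (hD y (hsub hy)).continuousAt.continuousWithinAt)
        (fun y hy => hD y (hsub (Ioo_subset_Icc_self hy)))
  choose ζ hζ hDζ using hmvt
  have hζ₀ : Tendsto ζ atTop (𝓝[>] 0) := tendsto_nhdsWithin_iff.2
    ⟨squeeze_zero (fun n => ((hξ₀ n).trans (hζ n).1).le) (fun n => (hζ n).2.le)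
      (h.tendsto_iterate hx), Eventually.of_forall fun n => (hξ₀ n).trans (hζ n).1⟩
  refine squeeze_zero_norm (fun n => ?_) (tendsto_zero_iff_norm_tendsto_zero.1 (hD'.comp hζ₀))
  have hdisp := h.disp_pos (hmem n)
  have hle : g^[n] x - ξ n ≤ disp g (g^[n] x) := sub_le_sub_left (hξ n).1.le _
  rw [hDζ, norm_div, norm_mul, Real.norm_of_nonneg hdisp.le,
    Real.norm_of_nonneg (sub_pos.2 (hξ n).2).le, div_le_iff₀ hdisp]
  exact mul_le_mul_of_nonneg_left hle (norm_nonneg _)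

end IntervalContraction

/-- `g` is a `C²` diffeomorphism of `[0, L]`, with first two derivatives `g'` and `g''`, that is
parabolic at both endpoints and moves all interior points towards `0`. All the estimates below
depend on `g` only through `C`, which bounds `L`, `1 / g'`, `|g''|` and the nonlinearity
`|g'' / g'|`. -/
structure ParabolicContraction (C L : ℝ) (g g' g'' : ℝ → ℝ) : Prop
    extends IntervalContraction L g where
  le : L ≤ C
  hasDerivWithinAt : ∀ x ∈ Icc 0 L, HasDerivWithinAt g (g' x) (Icc 0 L) x
  hasDerivWithinAt_deriv : ∀ x ∈ Icc 0 L, HasDerivWithinAt g' (g'' x) (Icc 0 L) x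
  continuousOn_deriv₂ : ContinuousOn g'' (Icc 0 L)
  deriv_zero : g' 0 = 1
  deriv_right : g' L = 1
  one_le : ∀ x ∈ Icc 0 L, 1 ≤ C * g' x
  abs_deriv₂_le : ∀ x ∈ Icc 0 L, |g'' x| ≤ C
  abs_deriv₂_le_mul : ∀ x ∈ Icc 0 L, |g'' x| ≤ C * g' x

namespace ParabolicContraction

variable {C L x : ℝ} {g g' g'' : ℝ → ℝ}

theorem const_pos (h : ParabolicContraction C L g g' g'') : 0 < C := h.pos.trans_le h.le

theorem hasDerivAt (h : ParabolicContraction C L g g' g'') (hx : x ∈ Ioo 0 L) :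
    HasDerivAt g (g' x) x :=
  (h.hasDerivWithinAt x (Ioo_subset_Icc_self hx)).hasDerivAt (Icc_mem_nhds hx.1 hx.2)

theorem hasDerivAt_deriv (h : ParabolicContraction C L g g' g'') (hx : x ∈ Ioo 0 L) :
    HasDerivAt g' (g'' x) x :=
  (h.hasDerivWithinAt_deriv x (Ioo_subset_Icc_self hx)).hasDerivAt (Icc_mem_nhds hx.1 hx.2)

theorem continuousOn_deriv (h : ParabolicContraction C L g g' g'') :
    ContinuousOn g' (Icc 0 L) :=
  fun x hx => (h.hasDerivWithinAt_deriv x hx).continuousWithinAt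

theorem deriv_pos (h : ParabolicContraction C L g g' g'') (hx : x ∈ Icc 0 L) : 0 < g' x :=
  pos_of_mul_pos_right (one_pos.trans_le (h.one_le x hx)) h.const_pos.le

theorem hasDerivAt_disp (h : ParabolicContraction C L g g' g'') (hx : x ∈ Ioo 0 L) :
    HasDerivAt (disp g) (1 - g' x) x :=
  (hasDerivAt_id x).sub (h.hasDerivAt hx)

theorem abs_deriv_sub_le (h : ParabolicContraction C L g g' g'') {s t : ℝ} (hs : s ∈ Icc 0 L)
    (ht : t ∈ Icc 0 L) : |g' t - g' s| ≤ C * |t - s| :=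
  (convex_Icc 0 L).norm_image_sub_le_of_norm_hasDerivWithin_le h.hasDerivWithinAt_deriv
    h.abs_deriv₂_le hs ht

theorem abs_one_sub_deriv_le (h : ParabolicContraction C L g g' g'') (hx : x ∈ Icc 0 L) :
    |1 - g' x| ≤ C * x := by
  simpa only [h.deriv_zero, zero_sub, abs_neg, abs_of_nonneg hx.1] using
    h.abs_deriv_sub_le hx (left_mem_Icc.2 h.pos.le)

theorem abs_nonlinearity_le (h : ParabolicContraction C L g g' g'') (hx : x ∈ Icc 0 L) :
    |g'' x / g' x| ≤ C := by
  rw [abs_div, abs_of_pos (h.deriv_pos hx), div_le_iff₀ (h.deriv_pos hx)]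
  exact h.abs_deriv₂_le_mul x hx

theorem abs_log_deriv_sub_le (h : ParabolicContraction C L g g' g'') {s t : ℝ}
    (hs : s ∈ Icc 0 L) (ht : t ∈ Icc 0 L) :
    |Real.log (g' t) - Real.log (g' s)| ≤ C * |t - s| :=
  (convex_Icc 0 L).norm_image_sub_le_of_norm_hasDerivWithin_le
    (fun x hx => (h.hasDerivWithinAt_deriv x hx).log (h.deriv_pos hx).ne')
    (fun _ => h.abs_nonlinearity_le) hs ht

theorem disp_le_mul_sq (h : ParabolicContraction C L g g' g'') (hx : x ∈ Ioo 0 L) :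
    disp g x ≤ C * x ^ 2 := by
  obtain ⟨ξ, hξ, hslope⟩ := exists_sub_eq_deriv_mul hx.1
    (h.continuousOn_disp.mono (Icc_subset_Icc_right hx.2.le))
    (fun y hy => h.hasDerivAt_disp (Ioo_subset_Ioo_right hx.2.le hy))
  rw [h.disp_zero, sub_zero, sub_zero] at hslope
  have hξx : 1 - g' ξ ≤ C * x :=
    (le_abs_self _).trans ((h.abs_one_sub_deriv_le ⟨hξ.1.le, (hξ.2.trans hx.2).le⟩).trans
      (mul_le_mul_of_nonneg_left hξ.2.le h.const_pos.le))
  calc disp g x = (1 - g' ξ) * x := hslope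
    _ ≤ C * x * x := mul_le_mul_of_nonneg_right hξx hx.1.le
    _ = C * x ^ 2 := by ring

theorem exists_disp_apply_eq (h : ParabolicContraction C L g g' g'') (hx : x ∈ Ioo 0 L) :
    ∃ ξ ∈ Ioo (g x) x, disp g (g x) = g' ξ * disp g x := by
  have hgx := (h.mapsTo hx).1.le
  exact exists_sub_eq_deriv_mul (h.lt_self x hx)
    (h.continuousOn.mono (Icc_subset_Icc hgx hx.2.le))
    (fun y hy => h.hasDerivAt (Ioo_subset_Ioo hgx hx.2.le hy))

theorem iterDeriv_pos (h : ParabolicContraction C L g g' g'') (hx : x ∈ Ioo 0 L) (n : ℕ) :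
    0 < iterDeriv g g' n x :=
  Finset.prod_pos fun i _ => h.deriv_pos (Ioo_subset_Icc_self (h.iterate_mem hx i))

theorem hasDerivAt_iterate (h : ParabolicContraction C L g g' g'') (hx : x ∈ Ioo 0 L) (n : ℕ) :
    HasDerivAt (g^[n]) (iterDeriv g g' n x) x := by
  induction n with
  | zero =>
    rw [iterDeriv_zero, Function.iterate_zero]
    exact hasDerivAt_id x
  | succ n ih =>
    rw [Function.iterate_succ', iterDeriv_succ, mul_comm]
    exact (h.hasDerivAt (h.iterate_mem hx n)).comp x ih

theorem continuousOn_iterate (h : ParabolicContraction C L g g' g'') (n : ℕ) :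
    ContinuousOn (g^[n]) (Ioo 0 L) :=
  fun _ hx => (h.hasDerivAt_iterate hx n).continuousAt.continuousWithinAt

theorem continuousOn_iterDeriv (h : ParabolicContraction C L g g' g'') (n : ℕ) :
    ContinuousOn (iterDeriv g g' n) (Ioo 0 L) :=
  continuousOn_finsetProd _ fun i _ => (h.continuousOn_deriv.mono Ioo_subset_Icc_self).comp
    (h.continuousOn_iterate i) fun _ hx => h.iterate_mem hx i

end ParabolicContraction

/-- The logarithm of `disp g (g^[n] x)` over the derivative of `g^[n]` at `x`. Pulling back the
displacement, an approximate vector field of `g` near `0`, these functions converge to the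
logarithm of the Szekeres vector field. -/
noncomputable def logApprox (g g' : ℝ → ℝ) (n : ℕ) (x : ℝ) : ℝ :=
  Real.log (disp g (g^[n] x)) - ∑ i ∈ Finset.range n, Real.log (g' (g^[i] x))

/-- The logarithm of the Szekeres vector field, the limit of `logApprox g g' n`. -/
noncomputable def logField (g g' : ℝ → ℝ) (x : ℝ) : ℝ :=
  limUnder atTop fun n => logApprox g g' n x

/-- The derivative of `log (g' ∘ g^[i])`, where `g'` and `g''` are the derivatives of `g`. -/
noncomputable def logIterDeriv (g g' g'' : ℝ → ℝ) (i : ℕ) (x : ℝ) : ℝ :=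
  g'' (g^[i] x) / g' (g^[i] x) * iterDeriv g g' i x

/-- The derivative of `logApprox g g' n`. -/
noncomputable def logApproxDeriv (g g' g'' : ℝ → ℝ) (n : ℕ) (x : ℝ) : ℝ :=
  (1 - g' (g^[n] x)) * iterDeriv g g' n x / disp g (g^[n] x) -
    ∑ i ∈ Finset.range n, logIterDeriv g g' g'' i x

/-- The derivative of `logField g g'`. -/
noncomputable def logFieldDeriv (g g' g'' : ℝ → ℝ) (x : ℝ) : ℝ :=
  -∑' i, logIterDeriv g g' g'' i x

/-- The Szekeres vector field on `[0, L]` of the inverse of `g`, which vanishes at `0` and `L`. The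
inverse is used to have a positive field. -/
noncomputable def szekeres (L : ℝ) (g g' : ℝ → ℝ) : ℝ → ℝ :=
  (Ioo 0 L).indicator fun x => Real.exp (logField g g' x)

section Szekeres

variable {L x : ℝ} {g g' : ℝ → ℝ}

theorem szekeres_of_mem (hx : x ∈ Ioo 0 L) : szekeres L g g' x = Real.exp (logField g g' x) :=
  indicator_of_mem hx _

theorem szekeres_zero : szekeres L g g' 0 = 0 :=
  indicator_of_notMem (by simp) _

theorem szekeres_right : szekeres L g g' L = 0 :=
  indicator_of_notMem (by simp) _

theorem szekeres_nonneg (x : ℝ) : 0 ≤ szekeres L g g' x :=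
  indicator_nonneg (fun _ _ => (Real.exp_pos _).le) x

theorem szekeres_pos (hx : x ∈ Ioo 0 L) : 0 < szekeres L g g' x := by
  rw [szekeres_of_mem hx]
  exact Real.exp_pos _

end Szekeres

namespace ParabolicContraction

variable {C L x : ℝ} {g g' g'' : ℝ → ℝ}

/-- By the mean value theorem, `disp g (g y) / disp g y` is a value of `g'` between `g y` and `y`,
so the increments telescope along an orbit. -/
theorem abs_logApprox_succ_sub_le (h : ParabolicContraction C L g g' g'') (hx : x ∈ Ioo 0 L)
    (n : ℕ) :
    |logApprox g g' (n + 1) x - logApprox g g' n x| ≤ C * (g^[n] x - g^[n + 1] x) := by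
  have hn := h.iterate_mem hx n
  obtain ⟨ξ, hξ, hdisp⟩ := h.exists_disp_apply_eq hn
  rw [← Function.iterate_succ_apply' g n x] at hξ hdisp
  have hξI : ξ ∈ Icc 0 L := ⟨((h.iterate_mem hx (n + 1)).1.trans hξ.1).le, (hξ.2.trans hn.2).le⟩
  have hlog : logApprox g g' (n + 1) x - logApprox g g' n x =
      Real.log (g' ξ) - Real.log (g' (g^[n] x)) := by
    rw [logApprox, logApprox, hdisp, Real.log_mul (h.deriv_pos hξI).ne' (h.disp_pos hn).ne',
      Finset.sum_range_succ]
    ring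
  rw [hlog]
  refine (h.abs_log_deriv_sub_le (Ioo_subset_Icc_self hn) hξI).trans
    (mul_le_mul_of_nonneg_left ?_ h.const_pos.le)
  rw [abs_sub_comm, abs_of_pos (sub_pos.2 hξ.2)]
  exact sub_le_sub_left hξ.1.le _

theorem abs_logApprox_sub_le (h : ParabolicContraction C L g g' g'') (hx : x ∈ Ioo 0 L)
    {n m : ℕ} (hnm : n ≤ m) :
    |logApprox g g' m x - logApprox g g' n x| ≤ C * g^[n] x := by
  have htelescope : |logApprox g g' m x - logApprox g g' n x| ≤ C * (g^[n] x - g^[m] x) := by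
    induction m, hnm using Nat.le_induction with
    | base => simp
    | succ m _ ih =>
      calc |logApprox g g' (m + 1) x - logApprox g g' n x|
          ≤ |logApprox g g' (m + 1) x - logApprox g g' m x| +
            |logApprox g g' m x - logApprox g g' n x| := abs_sub_le _ _ _
        _ ≤ C * (g^[m] x - g^[m + 1] x) + C * (g^[n] x - g^[m] x) :=
            add_le_add (h.abs_logApprox_succ_sub_le hx m) ih
        _ = C * (g^[n] x - g^[m + 1] x) := by ring
  exact htelescope.trans (mul_le_mul_of_nonneg_left
    (sub_le_self _ (h.iterate_mem hx m).1.le) h.const_pos.le)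

theorem tendsto_logApprox (h : ParabolicContraction C L g g' g'') (hx : x ∈ Ioo 0 L) :
    Tendsto (fun n => logApprox g g' n x) atTop (𝓝 (logField g g' x)) := by
  refine (cauchySeq_of_le_tendsto_0' (fun n => C * g^[n] x) (fun n m hnm => ?_) ?_).tendsto_limUnder
  · rw [dist_comm]
    exact h.abs_logApprox_sub_le hx hnm
  · simpa only [mul_zero] using (h.tendsto_iterate hx).const_mul C

theorem abs_logField_sub_log_disp_le (h : ParabolicContraction C L g g' g'') (hx : x ∈ Ioo 0 L) :
    |logField g g' x - Real.log (disp g x)| ≤ C * x := by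
  refine le_of_tendsto' ((h.tendsto_logApprox hx).sub_const _).abs fun m => ?_
  simpa [logApprox] using h.abs_logApprox_sub_le hx (Nat.zero_le m)

theorem logField_apply (h : ParabolicContraction C L g g' g'') (hx : x ∈ Ioo 0 L) :
    logField g g' (g x) = logField g g' x + Real.log (g' x) := by
  refine tendsto_nhds_unique (h.tendsto_logApprox (h.mapsTo hx))
    ((((tendsto_add_atTop_iff_nat 1).2 (h.tendsto_logApprox hx)).add_const _).congr fun n => ?_)
  simp only [logApprox, Finset.sum_range_succ', Function.iterate_succ_apply,
    Function.iterate_zero_apply]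
  ring

theorem szekeres_apply (h : ParabolicContraction C L g g' g'') (hx : x ∈ Ioo 0 L) :
    szekeres L g g' (g x) = g' x * szekeres L g g' x := by
  rw [szekeres_of_mem (h.mapsTo hx), szekeres_of_mem hx, h.logField_apply hx, Real.exp_add,
    Real.exp_log (h.deriv_pos (Ioo_subset_Icc_self hx)), mul_comm]

theorem szekeres_iterate (h : ParabolicContraction C L g g' g'') (hx : x ∈ Ioo 0 L) (n : ℕ) :
    szekeres L g g' (g^[n] x) = iterDeriv g g' n x * szekeres L g g' x :=
  h.apply_iterate_eq_iterDeriv_mul (fun _ => h.szekeres_apply) hx n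

theorem szekeres_div_disp_mem (h : ParabolicContraction C L g g' g'') (hx : x ∈ Ioo 0 L) :
    szekeres L g g' x / disp g x ∈ Icc (Real.exp (-(C * x))) (Real.exp (C * x)) := by
  have hlog := abs_le.1 (h.abs_logField_sub_log_disp_le hx)
  have hquot : szekeres L g g' x / disp g x =
      Real.exp (logField g g' x - Real.log (disp g x)) := by
    rw [szekeres_of_mem hx, Real.exp_sub, Real.exp_log (h.disp_pos hx)]
  rw [hquot]
  exact ⟨Real.exp_le_exp.2 hlog.1, Real.exp_le_exp.2 hlog.2⟩

theorem tendsto_szekeres_div_disp (h : ParabolicContraction C L g g' g'') :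
    Tendsto (fun x => szekeres L g g' x / disp g x) (𝓝[>] 0) (𝓝 1) := by
  have hexp : ∀ c : ℝ, Tendsto (fun x => Real.exp (c * x)) (𝓝[>] 0) (𝓝 1) := fun c => by
    have hcont : Continuous fun x => Real.exp (c * x) := by fun_prop
    simpa only [mul_zero, Real.exp_zero] using (hcont.tendsto 0).mono_left nhdsWithin_le_nhds
  refine tendsto_of_tendsto_of_tendsto_of_le_of_le' (hexp (-C)) (hexp C) ?_ ?_ <;>
    filter_upwards [Ioo_mem_nhdsGT h.pos] with x hx
  · simpa only [neg_mul] using (h.szekeres_div_disp_mem hx).1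
  · exact (h.szekeres_div_disp_mem hx).2

theorem tendsto_szekeres_div_disp_iterate (h : ParabolicContraction C L g g' g'')
    (hx : x ∈ Ioo 0 L) :
    Tendsto (fun n => szekeres L g g' (g^[n] x) / disp g (g^[n] x)) atTop (𝓝 1) :=
  h.tendsto_szekeres_div_disp.comp (h.tendsto_iterate_nhdsGT hx)

theorem mul_le_const_sq (h : ParabolicContraction C L g g' g'') (hx : x ∈ Ioo 0 L) :
    C * x ≤ C ^ 2 := by
  rw [sq]
  exact mul_le_mul_of_nonneg_left (hx.2.le.trans h.le) h.const_pos.le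

theorem szekeres_le (h : ParabolicContraction C L g g' g'') (hx : x ∈ Ioo 0 L) :
    szekeres L g g' x ≤ Real.exp (C ^ 2) * disp g x :=
  (div_le_iff₀ (h.disp_pos hx)).1 ((h.szekeres_div_disp_mem hx).2.trans
    (Real.exp_le_exp.2 (h.mul_le_const_sq hx)))

theorem disp_le_szekeres (h : ParabolicContraction C L g g' g'') (hx : x ∈ Ioo 0 L) :
    disp g x ≤ Real.exp (C ^ 2) * szekeres L g g' x := by
  rw [← inv_mul_le_iff₀ (Real.exp_pos _), ← Real.exp_neg, ← le_div_iff₀ (h.disp_pos hx)]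
  exact (Real.exp_le_exp.2 (neg_le_neg (h.mul_le_const_sq hx))).trans
    (h.szekeres_div_disp_mem hx).1

theorem iterDeriv_mul_disp_le (h : ParabolicContraction C L g g' g'') (hx : x ∈ Ioo 0 L) (n : ℕ) :
    iterDeriv g g' n x * disp g x ≤ Real.exp (C ^ 2) ^ 2 * disp g (g^[n] x) :=
  calc iterDeriv g g' n x * disp g x
      ≤ iterDeriv g g' n x * (Real.exp (C ^ 2) * szekeres L g g' x) :=
        mul_le_mul_of_nonneg_left (h.disp_le_szekeres hx) (h.iterDeriv_pos hx n).le
    _ = Real.exp (C ^ 2) * szekeres L g g' (g^[n] x) := by rw [h.szekeres_iterate hx]; ring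
    _ ≤ Real.exp (C ^ 2) * (Real.exp (C ^ 2) * disp g (g^[n] x)) :=
        mul_le_mul_of_nonneg_left (h.szekeres_le (h.iterate_mem hx n)) (Real.exp_pos _).le
    _ = Real.exp (C ^ 2) ^ 2 * disp g (g^[n] x) := by ring

theorem iterDeriv_le (h : ParabolicContraction C L g g' g'') (hx : x ∈ Ioo 0 L) (n : ℕ) :
    iterDeriv g g' n x ≤ Real.exp (C ^ 2) ^ 2 / disp g x * disp g (g^[n] x) := by
  rw [div_mul_eq_mul_div, le_div_iff₀ (h.disp_pos hx)]
  exact h.iterDeriv_mul_disp_le hx n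

theorem hasDerivAt_logApprox (h : ParabolicContraction C L g g' g'') (hx : x ∈ Ioo 0 L) (n : ℕ) :
    HasDerivAt (logApprox g g' n) (logApproxDeriv g g' g'' n x) x := by
  have hn := h.iterate_mem hx n
  refine HasDerivAt.sub
    (((h.hasDerivAt_disp hn).comp x (h.hasDerivAt_iterate hx n)).log (h.disp_pos hn).ne')
    (HasDerivAt.fun_sum fun i _ => ?_)
  have hi := h.iterate_mem hx i
  rw [logIterDeriv, div_mul_eq_mul_div]
  exact ((h.hasDerivAt_deriv hi).comp x (h.hasDerivAt_iterate hx i)).log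
    (h.deriv_pos (Ioo_subset_Icc_self hi)).ne'

theorem abs_logIterDeriv_le (h : ParabolicContraction C L g g' g'') (hx : x ∈ Ioo 0 L) (i : ℕ) :
    |logIterDeriv g g' g'' i x| ≤
      C * Real.exp (C ^ 2) ^ 2 / disp g x * (g^[i] x - g^[i + 1] x) := by
  rw [logIterDeriv, abs_mul, abs_of_pos (h.iterDeriv_pos hx i)]
  calc _ ≤ C * (Real.exp (C ^ 2) ^ 2 / disp g x * disp g (g^[i] x)) :=
        mul_le_mul (h.abs_nonlinearity_le (Ioo_subset_Icc_self (h.iterate_mem hx i)))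
          (h.iterDeriv_le hx i) (h.iterDeriv_pos hx i).le h.const_pos.le
    _ = _ := by rw [Function.iterate_succ_apply', disp, disp]; ring

theorem sum_abs_logIterDeriv_le (h : ParabolicContraction C L g g' g'') (hx : x ∈ Ioo 0 L)
    {n m : ℕ} (hnm : n ≤ m) :
    ∑ i ∈ Finset.Ico n m, |logIterDeriv g g' g'' i x| ≤
      C * Real.exp (C ^ 2) ^ 2 / disp g x * g^[n] x := by
  have htelescope : ∑ i ∈ Finset.Ico n m, (g^[i] x - g^[i + 1] x) = g^[n] x - g^[m] x := by
    simpa only [Finset.sum_neg_distrib, neg_sub, sub_neg_eq_add, neg_add_eq_sub] using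
      Finset.sum_Ico_sub (fun i => -g^[i] x) hnm
  refine (Finset.sum_le_sum fun i _ => h.abs_logIterDeriv_le hx i).trans ?_
  rw [← Finset.mul_sum, htelescope]
  have := h.const_pos.le
  have := (h.disp_pos hx).le
  gcongr
  exact sub_le_self _ (h.iterate_mem hx m).1.le

theorem summable_logIterDeriv (h : ParabolicContraction C L g g' g'') (hx : x ∈ Ioo 0 L) :
    Summable fun i => logIterDeriv g g' g'' i x :=
  .of_abs <| summable_of_sum_range_le (fun _ => abs_nonneg _) fun n => by
    rw [Finset.range_eq_Ico]
    exact h.sum_abs_logIterDeriv_le hx (Nat.zero_le n)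

theorem abs_logFieldDeriv_add_sum_le (h : ParabolicContraction C L g g' g'') (hx : x ∈ Ioo 0 L)
    (n : ℕ) :
    |logFieldDeriv g g' g'' x + ∑ i ∈ Finset.range n, logIterDeriv g g' g'' i x| ≤
      C * Real.exp (C ^ 2) ^ 2 / disp g x * g^[n] x := by
  refine le_of_tendsto
    ((h.summable_logIterDeriv hx).hasSum.tendsto_sum_nat.neg.add_const _).abs ?_
  filter_upwards [eventually_ge_atTop n] with m hm
  rw [neg_add_eq_sub, abs_sub_comm, ← Finset.sum_Ico_eq_sub _ hm]
  exact (Finset.abs_sum_le_sum_abs _ _).trans (h.sum_abs_logIterDeriv_le hx hm)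

theorem abs_logFieldDeriv_sub_le (h : ParabolicContraction C L g g' g'') (hx : x ∈ Ioo 0 L)
    (n : ℕ) :
    |logFieldDeriv g g' g'' x - logApproxDeriv g g' g'' n x| ≤
      2 * C * Real.exp (C ^ 2) ^ 2 / disp g x * g^[n] x := by
  have hn := h.iterate_mem hx n
  have hfirst : |(1 - g' (g^[n] x)) * iterDeriv g g' n x / disp g (g^[n] x)| ≤
      C * Real.exp (C ^ 2) ^ 2 / disp g x * g^[n] x := by
    have hquot : 0 ≤ iterDeriv g g' n x / disp g (g^[n] x) :=
      div_nonneg (h.iterDeriv_pos hx n).le (h.disp_pos hn).le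
    rw [mul_div_assoc, abs_mul, abs_of_nonneg hquot]
    calc _ ≤ (C * g^[n] x) * (Real.exp (C ^ 2) ^ 2 / disp g x) :=
          mul_le_mul (h.abs_one_sub_deriv_le (Ioo_subset_Icc_self hn))
            ((div_le_iff₀ (h.disp_pos hn)).2 (h.iterDeriv_le hx n)) hquot
            (mul_nonneg h.const_pos.le hn.1.le)
      _ = _ := by ring
  rw [logApproxDeriv, ← sub_add, sub_add_eq_add_sub]
  calc _ ≤ _ := (abs_sub _ _).trans (add_le_add (h.abs_logFieldDeriv_add_sum_le hx n) hfirst)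
    _ = _ := by ring

theorem tendstoLocallyUniformlyOn_logApproxDeriv (h : ParabolicContraction C L g g' g'') :
    TendstoLocallyUniformlyOn (logApproxDeriv g g' g'') (logFieldDeriv g g' g'') atTop
      (Ioo 0 L) := by
  rw [Metric.tendstoLocallyUniformlyOn_iff]
  intro ε hε x hx
  have hdisp := h.disp_pos hx
  obtain ⟨z, hxz, hzL⟩ := exists_between hx.2
  have hz : z ∈ Ioo 0 L := ⟨hx.1.trans hxz, hzL⟩
  have hdisp_near : ∀ᶠ y in 𝓝 x, disp g x / 2 < disp g y :=
    (h.hasDerivAt_disp hx).continuousAt.eventually (lt_mem_nhds (half_lt_self hdisp))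
  refine ⟨{y | disp g x / 2 < disp g y ∧ y < z ∧ y ∈ Ioo 0 L}, mem_nhdsWithin_of_mem_nhds
    (hdisp_near.and ((gt_mem_nhds hxz).and (isOpen_Ioo.mem_nhds hx))), ?_⟩
  have hlim := (h.tendsto_iterate hz).const_mul (2 * C * Real.exp (C ^ 2) ^ 2 / (disp g x / 2))
  rw [mul_zero] at hlim
  filter_upwards [hlim.eventually (gt_mem_nhds hε)] with n hn y ⟨hydisp, hyz, hy⟩
  refine ((h.abs_logFieldDeriv_sub_le hy n).trans ?_).trans_lt hn
  have := h.const_pos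
  have := (h.iterate_mem hy n).1.le
  have := (h.iterate_lt_iterate hy hz hyz n).le
  gcongr

theorem continuousOn_logApproxDeriv (h : ParabolicContraction C L g g' g'') (n : ℕ) :
    ContinuousOn (logApproxDeriv g g' g'' n) (Ioo 0 L) := by
  have hmaps : ∀ i, MapsTo (g^[i]) (Ioo 0 L) (Icc 0 L) := fun i x hx =>
    Ioo_subset_Icc_self (h.iterate_mem hx i)
  refine (((continuousOn_const.sub
    (h.continuousOn_deriv.comp (h.continuousOn_iterate n) (hmaps n))).mul
    (h.continuousOn_iterDeriv n)).div
    (h.continuousOn_disp.comp (h.continuousOn_iterate n) (hmaps n))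
    fun x hx => (h.disp_pos (h.iterate_mem hx n)).ne').sub (continuousOn_finsetSum _ fun i _ => ?_)
  exact ((h.continuousOn_deriv₂.comp (h.continuousOn_iterate i) (hmaps i)).div
    (h.continuousOn_deriv.comp (h.continuousOn_iterate i) (hmaps i))
    fun x hx => (h.deriv_pos (hmaps i hx)).ne').mul (h.continuousOn_iterDeriv i)

theorem continuousOn_logFieldDeriv (h : ParabolicContraction C L g g' g'') :
    ContinuousOn (logFieldDeriv g g' g'') (Ioo 0 L) :=
  h.tendstoLocallyUniformlyOn_logApproxDeriv.continuousOn
    (Frequently.of_forall h.continuousOn_logApproxDeriv)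

theorem hasDerivAt_logField (h : ParabolicContraction C L g g' g'') (hx : x ∈ Ioo 0 L) :
    HasDerivAt (logField g g') (logFieldDeriv g g' g'' x) x :=
  hasDerivAt_of_tendstoLocallyUniformlyOn isOpen_Ioo h.tendstoLocallyUniformlyOn_logApproxDeriv
    (Eventually.of_forall fun n _ hy => h.hasDerivAt_logApprox hy n)
    (fun _ hy => h.tendsto_logApprox hy) hx

theorem hasDerivAt_szekeres (h : ParabolicContraction C L g g' g'') (hx : x ∈ Ioo 0 L) :
    HasDerivAt (szekeres L g g') (szekeres L g g' x * logFieldDeriv g g' g'' x) x := by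
  rw [szekeres_of_mem hx]
  refine (h.hasDerivAt_logField hx).exp.congr_of_eventuallyEq ?_
  filter_upwards [isOpen_Ioo.mem_nhds hx] with y hy using szekeres_of_mem hy

theorem abs_szekeres_deriv_le (h : ParabolicContraction C L g g' g'') (hx : x ∈ Ioo 0 L) :
    |szekeres L g g' x * logFieldDeriv g g' g'' x| ≤ C * Real.exp (C ^ 2) ^ 3 * x := by
  have hdisp := h.disp_pos hx
  have hlog : |logFieldDeriv g g' g'' x| ≤ C * Real.exp (C ^ 2) ^ 2 / disp g x * x := by
    simpa using h.abs_logFieldDeriv_add_sum_le hx 0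
  rw [abs_mul, abs_of_nonneg (szekeres_nonneg x)]
  calc _ ≤ Real.exp (C ^ 2) * disp g x * (C * Real.exp (C ^ 2) ^ 2 / disp g x * x) :=
        mul_le_mul (h.szekeres_le hx) hlog (abs_nonneg _) (by positivity)
    _ = _ := by field_simp

theorem tendsto_szekeres_deriv (h : ParabolicContraction C L g g' g'') :
    Tendsto (fun x => szekeres L g g' x * logFieldDeriv g g' g'' x) (𝓝[≥] 0) (𝓝 0) := by
  refine squeeze_zero_norm' (a := fun x => C * Real.exp (C ^ 2) ^ 3 * x) ?_ ?_
  · filter_upwards [Ico_mem_nhdsGE h.pos] with x hx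
    rcases hx.1.eq_or_lt with rfl | hx₀
    · simp [szekeres_zero]
    · exact h.abs_szekeres_deriv_le ⟨hx₀, hx.2⟩
  · refine Tendsto.mono_left ?_ nhdsWithin_le_nhds
    simpa only [mul_zero] using (continuous_const_mul (C * Real.exp (C ^ 2) ^ 3)).tendsto (0 : ℝ)

theorem continuousOn_szekeres (h : ParabolicContraction C L g g' g'') :
    ContinuousOn (szekeres L g g') (Icc 0 L) := by
  have hendpoint : ∀ x ∈ Icc 0 L, disp g x = 0 → szekeres L g g' x = 0 →
      ContinuousWithinAt (szekeres L g g') (Icc 0 L) x := by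
    intro x hx hdisp hX
    have hlim := (h.continuousOn_disp x hx).const_mul (Real.exp (C ^ 2))
    rw [ContinuousWithinAt, hdisp, mul_zero] at hlim
    rw [ContinuousWithinAt, hX]
    refine squeeze_zero' (Eventually.of_forall fun y => szekeres_nonneg y) ?_ hlim
    filter_upwards [self_mem_nhdsWithin] with y hy
    rcases eq_endpoints_or_mem_Ioo_of_mem_Icc hy with rfl | rfl | hyI
    · rw [szekeres_zero, h.disp_zero, mul_zero]
    · rw [szekeres_right, h.disp_right, mul_zero]
    · exact h.szekeres_le hyI
  intro x hx
  rcases eq_endpoints_or_mem_Ioo_of_mem_Icc hx with rfl | rfl | hxI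
  · exact hendpoint _ hx h.disp_zero szekeres_zero
  · exact hendpoint _ hx h.disp_right szekeres_right
  · exact (h.hasDerivAt_szekeres hxI).continuousAt.continuousWithinAt

theorem hasDerivWithinAt_szekeres (h : ParabolicContraction C L g g' g'') (hx : x ∈ Ico 0 L) :
    HasDerivWithinAt (szekeres L g g') (szekeres L g g' x * logFieldDeriv g g' g'' x)
      (Ico 0 L) x := by
  rcases hx.1.eq_or_lt with rfl | hx₀
  swap
  · exact (h.hasDerivAt_szekeres ⟨hx₀, hx.2⟩).hasDerivWithinAt
  rw [szekeres_zero, zero_mul]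
  have hO : szekeres L g g' =O[𝓝[Ico 0 L] 0] fun x => ‖x - 0‖ ^ 2 := by
    refine Asymptotics.IsBigO.of_bound (Real.exp (C ^ 2) * C) ?_
    filter_upwards [self_mem_nhdsWithin] with y hy
    rw [sub_zero, norm_pow, norm_norm, Real.norm_of_nonneg (szekeres_nonneg y),
      Real.norm_of_nonneg hy.1, mul_assoc]
    rcases hy.1.eq_or_lt with rfl | hy₀
    · simp [szekeres_zero]
    · exact (h.szekeres_le ⟨hy₀, hy.2⟩).trans
        (mul_le_mul_of_nonneg_left (h.disp_le_mul_sq ⟨hy₀, hy.2⟩) (Real.exp_pos _).le)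
  simpa using (hO.hasFDerivWithinAt (𝕜 := ℝ) hx one_lt_two).hasDerivWithinAt

theorem contDiffOn_szekeres (h : ParabolicContraction C L g g' g'') :
    ContDiffOn ℝ 1 (szekeres L g g') (Ico 0 L) := by
  rw [contDiffOn_one_iff_derivWithin (uniqueDiffOn_Ico 0 L)]
  refine ⟨fun x hx => (h.hasDerivWithinAt_szekeres hx).differentiableWithinAt, ?_⟩
  have hderiv : ContinuousOn (fun x => szekeres L g g' x * logFieldDeriv g g' g'' x)
      (Ico 0 L) := by
    intro x hx
    rcases hx.1.eq_or_lt with rfl | hx₀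
    · rw [ContinuousWithinAt, szekeres_zero, zero_mul]
      exact h.tendsto_szekeres_deriv.mono_left (nhdsWithin_mono _ Ico_subset_Ici_self)
    · have hxI : x ∈ Ioo 0 L := ⟨hx₀, hx.2⟩
      exact ((h.hasDerivAt_szekeres hxI).continuousAt.mul
        (h.continuousOn_logFieldDeriv.continuousAt (isOpen_Ioo.mem_nhds hxI))).continuousWithinAt
  exact hderiv.congr fun x hx =>
    (h.hasDerivWithinAt_szekeres hx).derivWithin (uniqueDiffOn_Ico 0 L x hx)

end ParabolicContraction

theorem tendsto_derivWithin_nhdsGT_zero {D : ℝ → ℝ} {L : ℝ} (hL : 0 < L)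
    (hD : ContDiffOn ℝ 1 D (Ico 0 L)) (hD₀ : D 0 = 0) {ξ : ℕ → ℝ}
    (hξ : Tendsto ξ atTop (𝓝[>] 0)) (hDξ : ∀ n, D (ξ n) = 0) :
    Tendsto (derivWithin D (Ico 0 L)) (𝓝[>] 0) (𝓝 0) := by
  have hmem : (0 : ℝ) ∈ Ico 0 L := left_mem_Ico.2 hL
  have hderiv : derivWithin D (Ico 0 L) 0 = 0 := by
    have hslope := (hasDerivWithinAt_iff_tendsto_slope' self_notMem_Ioi).1
      ((hD.differentiableOn one_ne_zero 0 hmem).hasDerivWithinAt.mono_of_mem_nhdsWithin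
        (s := Ioi 0) (mem_of_superset (Ioo_mem_nhdsGT hL) Ioo_subset_Ico_self))
    refine tendsto_nhds_unique (hslope.comp hξ) (tendsto_const_nhds.congr fun n => ?_)
    simp only [Function.comp_apply, slope_def_field, hDξ, hD₀, sub_self, zero_div]
  have hcont := (hD.continuousOn_derivWithin (uniqueDiffOn_Ico 0 L) le_rfl 0 hmem).tendsto
  rw [hderiv, nhdsWithin_Ico_eq_nhdsGE hL] at hcont
  exact hcont.mono_left (nhdsWithin_mono _ Ioi_subset_Ici_self)

/-- `F` is the inverse of `g` on `[0, L)`, stated as a right inverse, which suffices when `g` is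
injective. -/
structure IsRightInverseOn (L : ℝ) (g F : ℝ → ℝ) : Prop where
  map_zero : F 0 = 0
  mapsTo : MapsTo F (Ioo 0 L) (Ioo 0 L)
  apply : ∀ x ∈ Ioo 0 L, g (F x) = x

namespace IntervalContraction

variable {L x : ℝ} {g F : ℝ → ℝ}

theorem lt_rightInverse (h : IntervalContraction L g) (hF : IsRightInverseOn L g F)
    (hx : x ∈ Ioo 0 L) : x < F x := by
  simpa only [hF.apply x hx] using h.lt_self _ (hF.mapsTo hx)

theorem rightInverse_apply (h : IntervalContraction L g) (hF : IsRightInverseOn L g F)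
    (hx : x ∈ Ioo 0 L) : F (g x) = x :=
  h.strictMonoOn.injOn (Ioo_subset_Icc_self (hF.mapsTo (h.mapsTo hx))) (Ioo_subset_Icc_self hx)
    (hF.apply _ (h.mapsTo hx))

end IntervalContraction

namespace ParabolicContraction

variable {C L x : ℝ} {g g' g'' F T Y : ℝ → ℝ}

theorem hasDerivAt_time_sub_apply (h : ParabolicContraction C L g g' g'')
    (hT : IsTimeFunctionOn T Y (Ioo 0 L)) (hx : x ∈ Ioo 0 L) :
    HasDerivAt (fun y => T y - T (g y)) ((Y x)⁻¹ - (Y (g x))⁻¹ * g' x) x :=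
  (hT x hx).sub ((hT (g x) (h.mapsTo hx)).comp x (h.hasDerivAt hx))

theorem time_sub_apply_eq (h : ParabolicContraction C L g g' g'')
    (hT : IsTimeFunctionOn T (szekeres L g g') (Ioo 0 L)) {y : ℝ} (hx : x ∈ Ioo 0 L)
    (hy : y ∈ Ioo 0 L) : T x - T (g x) = T y - T (g y) := by
  have hderiv : ∀ z ∈ Ioo 0 L, HasDerivAt (fun w => T w - T (g w)) 0 z := by
    intro z hz
    have hzero := h.hasDerivAt_time_sub_apply hT hz
    rwa [h.szekeres_apply hz, mul_inv_rev,
      inv_mul_cancel_right₀ (h.deriv_pos (Ioo_subset_Icc_self hz)).ne', sub_self] at hzero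
  exact isOpen_Ioo.is_const_of_deriv_eq_zero isPreconnected_Ioo
    (fun z hz => (hderiv z hz).differentiableAt.differentiableWithinAt)
    (fun z hz => (hderiv z hz).deriv) hx hy

theorem tendsto_szekeres_div_disp_of_mem (h : ParabolicContraction C L g g' g'')
    (hx : x ∈ Ioo 0 L) {ξ : ℕ → ℝ} (hξ : ∀ n, ξ n ∈ Ioo (g (g^[n] x)) (g^[n] x)) :
    Tendsto (fun n => szekeres L g g' (ξ n) / disp g (g^[n] x)) atTop (𝓝 1) := by
  have hsub := h.tendsto_sub_div_disp_iterate (fun y hy => h.hasDerivAt_szekeres hy)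
    (h.tendsto_szekeres_deriv.mono_left (nhdsWithin_mono _ Ioi_subset_Ici_self)) hx hξ
  have hlim := (h.tendsto_szekeres_div_disp_iterate hx).sub hsub
  rw [sub_zero] at hlim
  exact hlim.congr fun n => by rw [← sub_div, sub_sub_cancel]

/-- The constant value of `T x - T (g x)` is `disp g x / X ξ` for some `ξ` between `g x` and `x`,
which tends to `1` as `x` runs along an orbit. -/
theorem time_sub_apply_eq_one (h : ParabolicContraction C L g g' g'')
    (hT : IsTimeFunctionOn T (szekeres L g g') (Ioo 0 L)) (hx : x ∈ Ioo 0 L) :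
    T x - T (g x) = 1 := by
  have hmvt : ∀ n, ∃ ξ ∈ Ioo (g (g^[n] x)) (g^[n] x),
      T x - T (g x) = (szekeres L g g' ξ / disp g (g^[n] x))⁻¹ := by
    intro n
    have hn := h.iterate_mem hx n
    have hsub : Icc (g (g^[n] x)) (g^[n] x) ⊆ Ioo 0 L :=
      Icc_subset_Ioo (h.mapsTo hn).1 hn.2
    obtain ⟨ξ, hξ, hslope⟩ := exists_sub_eq_deriv_mul (h.lt_self _ hn) (hT.continuousOn.mono hsub)
      (fun y hy => hT y (hsub (Ioo_subset_Icc_self hy)))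
    exact ⟨ξ, hξ, by rw [h.time_sub_apply_eq hT hx hn, hslope, inv_div, disp, div_eq_inv_mul]⟩
  choose ξ hξ hTξ using hmvt
  have hlim := (h.tendsto_szekeres_div_disp_of_mem hx hξ).inv₀ one_ne_zero
  rw [inv_one] at hlim
  exact tendsto_nhds_unique (tendsto_const_nhds.congr hTξ) hlim

theorem exists_isTimeFunctionOn_szekeres (h : ParabolicContraction C L g g' g'') :
    ∃ T, IsTimeFunctionOn T (szekeres L g g') (Ioo 0 L) :=
  exists_isTimeFunctionOn (h.continuousOn_szekeres.mono Ioo_subset_Icc_self)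
    fun _ hx => (szekeres_pos hx).ne'

theorem isTimeOneMap_szekeres (h : ParabolicContraction C L g g' g'')
    (hF : IsRightInverseOn L g F) : IsTimeOneMap (szekeres L g g') (Ico 0 L) F := by
  obtain ⟨T, hT⟩ := h.exists_isTimeFunctionOn_szekeres
  refine hT.isTimeOneMap (h.continuousOn_szekeres.mono Ioo_subset_Icc_self)
    (fun _ => szekeres_pos) szekeres_zero hF.map_zero hF.mapsTo fun x hx => ?_
  simpa only [hF.apply x hx] using h.time_sub_apply_eq_one hT (hF.mapsTo hx)

theorem exists_time_of_isTimeOneMap (h : ParabolicContraction C L g g' g'')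
    (hF : IsRightInverseOn L g F) (hC : ContDiffOn ℝ 1 Y (Ico 0 L))
    (hY : IsTimeOneMap Y (Ico 0 L) F) (hpos : ∀ x ∈ Ioo 0 L, 0 < Y x) :
    ∃ T, IsTimeFunctionOn T Y (Ioo 0 L) ∧ ∀ x ∈ Ioo 0 L, T x - T (g x) = 1 := by
  obtain ⟨T, hT⟩ := exists_isTimeFunctionOn (hC.continuousOn.mono Ioo_subset_Ico_self)
    fun x hx => (hpos x hx).ne'
  have hY₀ : Y 0 = 0 :=
    hY.eq_zero_of_isLeast ⟨left_mem_Ico.2 h.pos, fun _ hx => hx.1⟩ hF.map_zero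
  refine ⟨T, hT, fun x hx => ?_⟩
  simpa only [h.rightInverse_apply hF hx] using
    hY.time_apply_sub_eq_one hT hY₀.ge hpos (h.mapsTo hx)

theorem apply_eq_deriv_mul (h : ParabolicContraction C L g g' g'')
    (hpos : ∀ x ∈ Ioo 0 L, 0 < Y x) (hT : IsTimeFunctionOn T Y (Ioo 0 L))
    (hT₁ : ∀ x ∈ Ioo 0 L, T x - T (g x) = 1) (hx : x ∈ Ioo 0 L) : Y (g x) = g' x * Y x := by
  have hconst : HasDerivAt (fun y => T y - T (g y)) 0 x :=
    (hasDerivAt_const x (1 : ℝ)).congr_of_eventuallyEq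
      (mem_of_superset (Ioo_mem_nhds hx.1 hx.2) hT₁)
  have hzero := (h.hasDerivAt_time_sub_apply hT hx).unique hconst
  have hYx := (hpos x hx).ne'
  have hYgx := (hpos _ (h.mapsTo hx)).ne'
  field_simp at hzero
  linarith

theorem exists_eq_of_time_sub_apply_eq (h : ParabolicContraction C L g g' g'') {X S : ℝ → ℝ}
    (hS : IsTimeFunctionOn S X (Ioo 0 L)) (hT : IsTimeFunctionOn T Y (Ioo 0 L))
    (hx : x ∈ Ioo 0 L) (hST : S x - S (g x) = T x - T (g x)) :
    ∃ ξ ∈ Ioo (g x) x, Y ξ = X ξ := by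
  have hsub : Icc (g x) x ⊆ Ioo 0 L := Icc_subset_Ioo (h.mapsTo hx).1 hx.2
  obtain ⟨ξ, hξ, hslope⟩ := exists_hasDerivAt_eq_zero (f := fun y => T y - S y)
    (h.lt_self x hx) ((hT.continuousOn.mono hsub).sub (hS.continuousOn.mono hsub))
    (by linarith) fun y hy =>
      (hT y (hsub (Ioo_subset_Icc_self hy))).sub (hS y (hsub (Ioo_subset_Icc_self hy)))
  exact ⟨ξ, hξ, inv_injective (sub_eq_zero.1 hslope)⟩

/-- By the mean value theorem `D (g^[n] x) / X (g^[n] x)` tends to `0`, while `D / X` is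
`g`-invariant. -/
theorem eq_zero_of_apply_eq_deriv_mul {D : ℝ → ℝ} (h : ParabolicContraction C L g g' g'')
    (hC : ContDiffOn ℝ 1 D (Ico 0 L)) (hD₀ : D 0 = 0)
    (hD : ∀ y ∈ Ioo 0 L, D (g y) = g' y * D y) (hx : x ∈ Ioo 0 L) {ξ : ℝ} (hξ : ξ ∈ Ioo (g x) x)
    (hDξ : D ξ = 0) : D x = 0 := by
  have hξmem : ξ ∈ Ioo 0 L := ⟨(h.mapsTo hx).1.trans hξ.1, hξ.2.trans hx.2⟩
  have hbetween : ∀ n, g^[n] ξ ∈ Ioo (g (g^[n] x)) (g^[n] x) := fun n => by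
    rw [← Function.iterate_succ_apply' g, Function.iterate_succ_apply]
    exact ⟨h.iterate_lt_iterate (h.mapsTo hx) hξmem hξ.1 n,
      h.iterate_lt_iterate hξmem hx hξ.2 n⟩
  have hzero : ∀ n, D (g^[n] ξ) = 0 := fun n => by
    rw [h.apply_iterate_eq_iterDeriv_mul hD hξmem, hDξ, mul_zero]
  have hlim := h.tendsto_sub_div_disp_iterate
    (fun y hy => ((hC.differentiableOn one_ne_zero y (Ioo_subset_Ico_self hy)).hasDerivWithinAt
      |>.hasDerivAt (Ico_mem_nhds hy.1 hy.2)))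
    (tendsto_derivWithin_nhdsGT_zero h.pos hC hD₀ (h.tendsto_iterate_nhdsGT hξmem) hzero)
    hx hbetween
  have hquot := hlim.div (h.tendsto_szekeres_div_disp_iterate hx) one_ne_zero
  rw [zero_div] at hquot
  have hconst : D x / szekeres L g g' x = 0 :=
    tendsto_nhds_unique (tendsto_const_nhds.congr fun n => by
      rw [Pi.div_apply, hzero, sub_zero,
        div_div_div_cancel_right₀ (h.disp_pos (h.iterate_mem hx n)).ne',
        h.apply_iterate_eq_iterDeriv_mul hD hx, h.szekeres_iterate hx,
        mul_div_mul_left _ _ (h.iterDeriv_pos hx n).ne']) hquot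
  exact (div_eq_zero_iff.1 hconst).resolve_right (szekeres_pos hx).ne'

theorem eqOn_szekeres (h : ParabolicContraction C L g g' g'') (hF : IsRightInverseOn L g F)
    (hC : ContDiffOn ℝ 1 Y (Ico 0 L)) (hY : IsTimeOneMap Y (Ico 0 L) F) :
    EqOn Y (szekeres L g g') (Ico 0 L) := by
  have hY₀ : Y 0 = 0 :=
    hY.eq_zero_of_isLeast ⟨left_mem_Ico.2 h.pos, fun _ hx => hx.1⟩ hF.map_zero
  intro x hx
  rcases hx.1.eq_or_lt with rfl | hx₀
  · rw [hY₀, szekeres_zero]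
  have hx : x ∈ Ioo 0 L := ⟨hx₀, hx.2⟩
  have hpos : ∀ y ∈ Ioo 0 L, 0 < Y y := fun y hy =>
    hY.pos_of_lt_apply hC hF.map_zero (fun _ => h.lt_rightInverse hF) hy
  obtain ⟨T, hT, hT₁⟩ := h.exists_time_of_isTimeOneMap hF hC hY hpos
  obtain ⟨S, hS⟩ := h.exists_isTimeFunctionOn_szekeres
  obtain ⟨ξ, hξ, hYξ⟩ := h.exists_eq_of_time_sub_apply_eq hS hT hx
    ((h.time_sub_apply_eq_one hS hx).trans (hT₁ x hx).symm)
  refine sub_eq_zero.1 (h.eq_zero_of_apply_eq_deriv_mul (D := fun y => Y y - szekeres L g g' y)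
    (hC.sub h.contDiffOn_szekeres) ?_ (fun y hy => ?_) hx hξ (sub_eq_zero.2 hYξ))
  · simp only [hY₀, szekeres_zero, sub_self]
  · rw [h.apply_eq_deriv_mul hpos hT hT₁ hy, h.szekeres_apply hy, mul_sub]

end ParabolicContraction

theorem abs_sub_sub_deriv_mul_le {φ φ' : ℝ → ℝ} {s : Set ℝ} {K x y : ℝ} (hs : Convex ℝ s)
    (hφ : ∀ z ∈ s, HasDerivWithinAt φ (φ' z) s z)
    (hLip : ∀ z ∈ s, ∀ w ∈ s, |φ' w - φ' z| ≤ K * |w - z|) (hK : 0 ≤ K) (hx : x ∈ s)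
    (hy : y ∈ s) : |φ y - φ x - φ' x * (y - x)| ≤ K * |y - x| * |y - x| := by
  have hsub : uIcc x y ⊆ s := hs.ordConnected.uIcc_subset hx hy
  have hmvt := (convex_uIcc x y).norm_image_sub_le_of_norm_hasDerivWithin_le
    (f := fun z => φ z - φ' x * z) (C := K * |y - x|)
    (fun z hz => ((hφ z (hsub hz)).mono hsub).sub ((hasDerivWithinAt_id z _).const_mul (φ' x)))
    (fun z hz => by
      rw [mul_one]
      exact (hLip x hx z (hsub hz)).trans
        (mul_le_mul_of_nonneg_left (abs_sub_left_of_mem_uIcc hz) hK))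
    left_mem_uIcc right_mem_uIcc
  rwa [Real.norm_eq_abs, Real.norm_eq_abs, sub_sub_sub_comm, ← mul_sub] at hmvt

/-- The second order Taylor bound at `x - φ' x / (2 * K)`, where the bound is smallest. -/
theorem sq_deriv_le {φ φ' : ℝ → ℝ} {s : Set ℝ} {K x : ℝ} (hs : Convex ℝ s)
    (hφ : ∀ z ∈ s, HasDerivWithinAt φ (φ' z) s z)
    (hLip : ∀ z ∈ s, ∀ w ∈ s, |φ' w - φ' z| ≤ K * |w - z|) (hK : 0 < K)
    (hnonneg : ∀ z ∈ s, 0 ≤ φ z) (hx : x ∈ s) (hmem : x - φ' x / (2 * K) ∈ s) :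
    φ' x ^ 2 ≤ 4 * K * φ x := by
  have htaylor := (abs_le.1 (abs_sub_sub_deriv_mul_le hs hφ hLip hK.le hx hmem)).2
  rw [mul_assoc, abs_mul_abs_self, sub_sub_cancel_left] at htaylor
  have hmin : φ' x * -(φ' x / (2 * K)) + K * (-(φ' x / (2 * K)) * -(φ' x / (2 * K))) =
      -(φ' x ^ 2 / (4 * K)) := by
    field_simp
    ring
  rw [mul_comm, ← div_le_iff₀ (by positivity)]
  linarith [hnonneg _ hmem]

theorem tendsto_nhdsGT_of_continuousOn {φ : ℝ → ℝ} {L : ℝ} (hL : 0 < L)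
    (hφ : ContinuousOn φ (Icc 0 L)) : Tendsto φ (𝓝[>] 0) (𝓝 (φ 0)) :=
  ((hφ 0 (left_mem_Icc.2 hL.le)).mono_of_mem_nhdsWithin (Icc_mem_nhdsGT hL)).tendsto

theorem abs_sub_le_mul_of_abs_succ_sub_le {u : ℕ → ℝ} {N n : ℕ} {ε : ℝ} (hNn : N ≤ n)
    (hu : ∀ k ≥ N, |u (k + 1) - u k| ≤ ε) : |u n - u N| ≤ ε * (n - N) := by
  rw [← Real.dist_eq, dist_comm]
  refine (dist_le_Ico_sum_of_dist_le (d := fun _ => ε) hNn fun {k} hk _ => ?_).trans_eq ?_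
  · rw [dist_comm, Real.dist_eq]
    exact hu k hk
  · rw [Finset.sum_const, Nat.card_Ico, nsmul_eq_mul, Nat.cast_sub hNn, mul_comm]

theorem tendsto_div_natCast_of_tendsto_sub {α : Type*} {l : Filter α} {u : ℕ → α → ℝ} {β : ℝ}
    (hbdd : ∀ n, ∃ B, ∀ᶠ y in l, |u n y| ≤ B)
    (hβ : Tendsto (fun p : ℕ × α => u (p.1 + 1) p.2 - u p.1 p.2) (atTop ×ˢ l) (𝓝 β)) :
    Tendsto (fun p : ℕ × α => u p.1 p.2 / p.1) (atTop ×ˢ l) (𝓝 β) := by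
  rw [Metric.tendsto_nhds]
  intro ε hε
  obtain ⟨pa, ha, pb, hb, hab⟩ :=
    eventually_prod_iff.1 (Metric.tendsto_nhds.1 hβ (ε / 2) (half_pos hε))
  obtain ⟨N, hN⟩ := eventually_atTop.1 ha
  obtain ⟨B, hB⟩ := hbdd N
  have hlarge : ∀ᶠ n : ℕ in atTop, 0 < n ∧ N ≤ n ∧ (B + N * |β|) / (ε / 2) < n :=
    (eventually_gt_atTop 0).and ((eventually_ge_atTop N).and
      ((tendsto_natCast_atTop_atTop (R := ℝ)).eventually_gt_atTop _))
  filter_upwards [hlarge.prod_mk (hb.and hB)]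
  rintro ⟨n, y⟩ ⟨⟨hn₀, hNn, hn⟩, hy, hyB⟩
  have hstep : |(u n y - n * β) - (u N y - N * β)| ≤ ε / 2 * (n - N) := by
    refine abs_sub_le_mul_of_abs_succ_sub_le (u := fun k => u k y - k * β) hNn fun k hk => ?_
    have hclose : |u (k + 1) y - u k y - β| ≤ ε / 2 := (hab (hN k hk) hy).le
    rwa [sub_sub_sub_comm, ← sub_mul, Nat.cast_add_one, add_sub_cancel_left, one_mul]
  have hn₀' : (0 : ℝ) < n := Nat.cast_pos.2 hn₀
  rw [div_lt_iff₀ (half_pos hε)] at hn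
  rw [Real.dist_eq, div_sub' hn₀'.ne', abs_div, abs_of_pos hn₀', div_lt_iff₀ hn₀']
  have hNβ : |N * β| = N * |β| := by rw [abs_mul, Nat.abs_cast]
  have hN₀ : 0 ≤ ε / 2 * N := by positivity
  calc |u n y - n * β|
      ≤ |(u n y - n * β) - (u N y - N * β)| + |u N y - N * β| := by
        simpa only [sub_add_cancel] using
          abs_add_le ((u n y - n * β) - (u N y - N * β)) (u N y - N * β)
    _ ≤ ε / 2 * (n - N) + (B + N * |β|) :=
        add_le_add hstep ((abs_sub _ _).trans (add_le_add hyB hNβ.le))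
    _ < ε * n := by linarith

/-- The inverse square root of the displacement: near a parabolic fixed point of multiplicity two
it is, up to a factor, a coordinate in which `g` is close to a translation. -/
noncomputable def invSqrtDisp (g : ℝ → ℝ) (x : ℝ) : ℝ := (√(disp g x))⁻¹

theorem invSqrtDisp_nonneg (g : ℝ → ℝ) (x : ℝ) : 0 ≤ invSqrtDisp g x :=
  inv_nonneg.2 (Real.sqrt_nonneg _)

theorem IntervalContraction.sq_invSqrtDisp {L x : ℝ} {g : ℝ → ℝ} (h : IntervalContraction L g)
    (hx : x ∈ Ioo 0 L) : invSqrtDisp g x ^ 2 = (disp g x)⁻¹ := by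
  rw [invSqrtDisp, inv_pow, Real.sq_sqrt (h.disp_pos hx).le]

theorem IntervalContraction.invSqrtDisp_apply_sub {L x : ℝ} {g : ℝ → ℝ}
    (h : IntervalContraction L g) (hx : x ∈ Ioo 0 L) :
    invSqrtDisp g (g x) - invSqrtDisp g x =
      (1 - disp g (g x) / disp g x) / √(disp g x) /
        (√(disp g (g x) / disp g x) * (1 + √(disp g (g x) / disp g x))) := by
  have hdisp := h.disp_pos hx
  have hratio : 0 < disp g (g x) / disp g x := div_pos (h.disp_pos (h.mapsTo hx)) hdisp
  have hmul : disp g (g x) = disp g (g x) / disp g x * disp g x :=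
    (div_mul_cancel₀ _ hdisp.ne').symm
  rw [invSqrtDisp, invSqrtDisp, hmul, mul_div_cancel_right₀ _ hdisp.ne', Real.sqrt_mul hratio.le]
  set q := disp g (g x) / disp g x
  have : 0 < √q := Real.sqrt_pos.2 hratio
  have : 0 < √(disp g x) := Real.sqrt_pos.2 hdisp
  have hfactor : 1 - q = (1 - √q) * (1 + √q) := by linear_combination Real.sq_sqrt hratio.le
  rw [hfactor]
  field_simp

namespace ParabolicContraction

variable {C L x : ℝ} {g g' g'' : ℝ → ℝ}

theorem hasDerivWithinAt_disp (h : ParabolicContraction C L g g' g'') :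
    ∀ x ∈ Icc 0 L, HasDerivWithinAt (disp g) (1 - g' x) (Icc 0 L) x :=
  fun x hx => (hasDerivWithinAt_id x _).sub (h.hasDerivWithinAt x hx)

theorem abs_one_sub_deriv_le_right (h : ParabolicContraction C L g g' g'') (hx : x ∈ Icc 0 L) :
    |1 - g' x| ≤ C * (L - x) := by
  simpa only [h.deriv_right, abs_of_nonneg (sub_nonneg.2 hx.2)] using
    h.abs_deriv_sub_le hx (right_mem_Icc.2 h.pos.le)

theorem sq_one_sub_deriv_le (h : ParabolicContraction C L g g' g'') (hx : x ∈ Icc 0 L) :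
    (1 - g' x) ^ 2 ≤ 4 * C * disp g x := by
  have hC := h.const_pos
  refine sq_deriv_le (convex_Icc 0 L) h.hasDerivWithinAt_disp (fun z hz w hw => ?_) hC
    (fun _ => h.disp_nonneg) hx ?_
  · rw [sub_sub_sub_cancel_left, abs_sub_comm]
    exact h.abs_deriv_sub_le hz hw
  · have hhalf : (1 - g' x) / (2 * C) * C = (1 - g' x) / 2 := by field_simp
    have hleft := abs_le.1 (h.abs_one_sub_deriv_le hx)
    have hright := abs_le.1 (h.abs_one_sub_deriv_le_right hx)
    constructor <;> nlinarith [hx.1, hx.2]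

theorem eventually_sq_one_sub_deriv_le (h : ParabolicContraction C L g g' g'') {K : ℝ}
    (hK : |g'' 0| < K) : ∀ᶠ x in 𝓝[>] 0, (1 - g' x) ^ 2 ≤ 4 * K * disp g x := by
  have hK₀ : 0 < K := (abs_nonneg _).trans_lt hK
  have hcont := (h.continuousOn_deriv₂ 0 (left_mem_Icc.2 h.pos.le)).mono_of_mem_nhdsWithin
    (Icc_mem_nhdsGE h.pos)
  obtain ⟨δ, hδ, hδK⟩ := (mem_nhdsGE_iff_exists_mem_Ioc_Ico_subset h.pos).1
    (hcont.abs.eventually (gt_mem_nhds hK))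
  have hsub : Ico 0 δ ⊆ Icc 0 L := fun y hy => ⟨hy.1, hy.2.le.trans hδ.2⟩
  have hLip : ∀ z ∈ Ico 0 δ, ∀ w ∈ Ico 0 δ, |g' w - g' z| ≤ K * |w - z| := fun z hz w hw =>
    (convex_Ico 0 δ).norm_image_sub_le_of_norm_hasDerivWithin_le
      (fun y hy => (h.hasDerivWithinAt_deriv y (hsub hy)).mono hsub)
      (fun y hy => le_of_lt (hδK hy)) hz hw
  filter_upwards [Ioo_mem_nhdsGT (half_pos hδ.1)] with x hx
  have hxδ : x ∈ Ico 0 δ := ⟨hx.1.le, hx.2.trans (half_lt_self hδ.1)⟩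
  refine sq_deriv_le (convex_Ico 0 δ)
    (fun y hy => (h.hasDerivWithinAt_disp y (hsub hy)).mono hsub) (fun z hz w hw => ?_) hK₀
    (fun y hy => h.disp_nonneg (hsub hy)) hxδ ?_
  · rw [sub_sub_sub_cancel_left, abs_sub_comm]
    exact hLip z hz w hw
  · have hhalf : (1 - g' x) / (2 * K) * K = (1 - g' x) / 2 := by field_simp
    have hbound := hLip 0 (left_mem_Ico.2 hδ.1) x hxδ
    rw [h.deriv_zero, abs_sub_comm, sub_zero, abs_of_pos hx.1, abs_le] at hbound
    constructor <;> nlinarith [hx.1, hx.2]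

theorem tendsto_one_sub_deriv_div (h : ParabolicContraction C L g g' g'') :
    Tendsto (fun x => (1 - g' x) / x) (𝓝[>] 0) (𝓝 (-g'' 0)) := by
  have hslope := (hasDerivWithinAt_iff_tendsto_slope' self_notMem_Ioi).1
    ((h.hasDerivWithinAt_deriv 0 (left_mem_Icc.2 h.pos.le)).mono_of_mem_nhdsWithin
      (Icc_mem_nhdsGT h.pos))
  refine hslope.neg.congr fun x => ?_
  rw [slope_def_field, h.deriv_zero, sub_zero, ← neg_div, neg_sub]

theorem tendsto_disp_div_sq (h : ParabolicContraction C L g g' g'') :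
    Tendsto (fun x => disp g x / x ^ 2) (𝓝[>] 0) (𝓝 (-g'' 0 / 2)) := by
  have hdisp : Tendsto (disp g) (𝓝[>] 0) (𝓝 0) := by
    simpa only [h.disp_zero] using tendsto_nhdsGT_of_continuousOn h.pos h.continuousOn_disp
  have hsq : Tendsto (fun x : ℝ => x ^ 2) (𝓝[>] 0) (𝓝 0) := by
    simpa only [zero_pow two_ne_zero] using
      tendsto_nhdsGT_of_continuousOn h.pos (continuousOn_pow (M := ℝ) 2)
  refine HasDerivAt.lhopital_zero_nhdsGT (f' := fun x => 1 - g' x) (g' := fun x => 2 * x)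
    ?_ ?_ ?_ hdisp hsq ?_
  · filter_upwards [Ioo_mem_nhdsGT h.pos] with x hx using h.hasDerivAt_disp hx
  · exact Eventually.of_forall fun x => by simpa using hasDerivAt_pow 2 x
  · filter_upwards [self_mem_nhdsWithin] with x hx using mul_ne_zero two_ne_zero (ne_of_gt hx)
  · refine (h.tendsto_one_sub_deriv_div.div_const 2).congr fun x => ?_
    rw [div_div, mul_comm x]

theorem deriv₂_zero_nonpos (h : ParabolicContraction C L g g' g'') : g'' 0 ≤ 0 := by
  have hnonneg : 0 ≤ -g'' 0 / 2 := by
    refine ge_of_tendsto h.tendsto_disp_div_sq ?_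
    filter_upwards [Ioo_mem_nhdsGT h.pos] with x hx
      using div_nonneg (h.disp_pos hx).le (sq_nonneg x)
  linarith

theorem tendsto_one_sub_deriv_div_sqrt_of_eq_zero (h : ParabolicContraction C L g g' g'')
    (hzero : g'' 0 = 0) : Tendsto (fun x => (1 - g' x) / √(disp g x)) (𝓝[>] 0) (𝓝 0) := by
  rw [Metric.tendsto_nhds]
  intro ε hε
  have hK : |g'' 0| < ε ^ 2 / 8 := by
    rw [hzero, abs_zero]
    positivity
  filter_upwards [h.eventually_sq_one_sub_deriv_le hK, Ioo_mem_nhdsGT h.pos] with x hsq hx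
  have hdisp := h.disp_pos hx
  rw [dist_zero_right, norm_div, Real.norm_eq_abs, Real.norm_of_nonneg (Real.sqrt_nonneg _),
    div_lt_iff₀ (Real.sqrt_pos.2 hdisp)]
  refine abs_lt_of_sq_lt_sq ?_ (by positivity)
  rw [mul_pow, Real.sq_sqrt hdisp.le]
  linarith [mul_pos (pow_pos hε 2) hdisp]

theorem tendsto_one_sub_deriv_div_sqrt (h : ParabolicContraction C L g g' g'') :
    Tendsto (fun x => (1 - g' x) / √(disp g x)) (𝓝[>] 0) (𝓝 (2 * √(-g'' 0 / 2))) := by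
  rcases h.deriv₂_zero_nonpos.eq_or_lt with hzero | hneg
  · simpa only [hzero, neg_zero, zero_div, Real.sqrt_zero, mul_zero] using
      h.tendsto_one_sub_deriv_div_sqrt_of_eq_zero hzero
  have hhalf : 0 < -g'' 0 / 2 := by linarith
  have hsqrt := (Real.sqrt_pos.2 hhalf).ne'
  have hlim := h.tendsto_one_sub_deriv_div.div h.tendsto_disp_div_sq.sqrt hsqrt
  have hconst : -g'' 0 / √(-g'' 0 / 2) = 2 * √(-g'' 0 / 2) := by
    rw [div_eq_iff hsqrt, mul_assoc, Real.mul_self_sqrt hhalf.le, mul_div_cancel₀ _ two_ne_zero]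
  rw [hconst] at hlim
  refine hlim.congr' ?_
  filter_upwards [self_mem_nhdsWithin] with x hx
  rw [Pi.div_apply, Real.sqrt_div' _ (sq_nonneg x), Real.sqrt_sq (le_of_lt hx),
    div_div_div_cancel_right₀ (ne_of_gt hx)]

theorem abs_dispRatio_sub_deriv_le (h : ParabolicContraction C L g g' g'') (hx : x ∈ Ioo 0 L) :
    |disp g (g x) / disp g x - g' x| ≤ C * disp g x := by
  obtain ⟨ξ, hξ, hslope⟩ := h.exists_disp_apply_eq hx
  have hξmem : ξ ∈ Icc 0 L := ⟨((h.mapsTo hx).1.trans hξ.1).le, (hξ.2.trans hx.2).le⟩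
  rw [hslope, mul_div_cancel_right₀ _ (h.disp_pos hx).ne']
  refine (h.abs_deriv_sub_le (Ioo_subset_Icc_self hx) hξmem).trans
    (mul_le_mul_of_nonneg_left ?_ h.const_pos.le)
  rw [abs_sub_comm, abs_of_pos (sub_pos.2 hξ.2)]
  exact sub_le_sub_left hξ.1.le _

theorem one_le_mul_dispRatio (h : ParabolicContraction C L g g' g'') (hx : x ∈ Ioo 0 L) :
    1 ≤ C * (disp g (g x) / disp g x) := by
  obtain ⟨ξ, hξ, hslope⟩ := h.exists_disp_apply_eq hx
  rw [hslope, mul_div_cancel_right₀ _ (h.disp_pos hx).ne']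
  exact h.one_le ξ ⟨((h.mapsTo hx).1.trans hξ.1).le, (hξ.2.trans hx.2).le⟩

theorem tendsto_dispRatio (h : ParabolicContraction C L g g' g'') :
    Tendsto (fun x => disp g (g x) / disp g x) (𝓝[>] 0) (𝓝 1) := by
  have hsub : Tendsto (fun x => disp g (g x) / disp g x - g' x) (𝓝[>] 0) (𝓝 0) := by
    refine squeeze_zero_norm' (a := fun x => C * disp g x) ?_ ?_
    · filter_upwards [Ioo_mem_nhdsGT h.pos] with x hx using h.abs_dispRatio_sub_deriv_le hx
    · simpa only [h.disp_zero, mul_zero] using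
        (tendsto_nhdsGT_of_continuousOn h.pos h.continuousOn_disp).const_mul C
  simpa only [sub_add_cancel, zero_add, h.deriv_zero] using
    hsub.add (tendsto_nhdsGT_of_continuousOn h.pos h.continuousOn_deriv)

theorem tendsto_one_sub_dispRatio_div_sqrt (h : ParabolicContraction C L g g' g'') :
    Tendsto (fun x => (1 - disp g (g x) / disp g x) / √(disp g x)) (𝓝[>] 0)
      (𝓝 (2 * √(-g'' 0 / 2))) := by
  have hsub : Tendsto (fun x => (disp g (g x) / disp g x - g' x) / √(disp g x)) (𝓝[>] 0)
      (𝓝 0) := by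
    refine squeeze_zero_norm' (a := fun x => C * √(disp g x)) ?_ ?_
    · filter_upwards [Ioo_mem_nhdsGT h.pos] with x hx
      have hdisp := h.disp_pos hx
      rw [norm_div, Real.norm_eq_abs, Real.norm_of_nonneg (Real.sqrt_nonneg _),
        div_le_iff₀ (Real.sqrt_pos.2 hdisp), mul_assoc, Real.mul_self_sqrt hdisp.le]
      exact h.abs_dispRatio_sub_deriv_le hx
    · simpa only [h.disp_zero, Real.sqrt_zero, mul_zero] using
        (tendsto_nhdsGT_of_continuousOn h.pos h.continuousOn_disp).sqrt.const_mul C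
  have hlim := h.tendsto_one_sub_deriv_div_sqrt.sub hsub
  rw [sub_zero] at hlim
  exact hlim.congr fun x => by rw [← sub_div, sub_sub_sub_cancel_right]

theorem tendsto_invSqrtDisp_apply_sub (h : ParabolicContraction C L g g' g'') :
    Tendsto (fun x => invSqrtDisp g (g x) - invSqrtDisp g x) (𝓝[>] 0) (𝓝 (√(-g'' 0 / 2))) := by
  have hden := h.tendsto_dispRatio.sqrt.mul (h.tendsto_dispRatio.sqrt.const_add 1)
  rw [Real.sqrt_one, one_mul, one_add_one_eq_two] at hden
  have hlim := h.tendsto_one_sub_dispRatio_div_sqrt.div hden two_ne_zero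
  rw [mul_div_cancel_left₀ _ two_ne_zero] at hlim
  refine hlim.congr' ?_
  filter_upwards [Ioo_mem_nhdsGT h.pos] with x hx using (h.invSqrtDisp_apply_sub hx).symm

theorem one_sub_dispRatio_le (h : ParabolicContraction C L g g' g'') (hx : x ∈ Ioo 0 L) :
    1 - disp g (g x) / disp g x ≤ (2 + C) * √C * √(disp g x) := by
  have hC := h.const_pos
  have hdisp := h.disp_pos hx
  have hsqrt : √(disp g x) ≤ √C :=
    Real.sqrt_le_sqrt ((h.disp_le_self hx).trans (hx.2.le.trans h.le))
  have hderiv : 1 - g' x ≤ 2 * √C * √(disp g x) := by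
    refine le_of_sq_le_sq ?_ (by positivity)
    rw [mul_pow, mul_pow, Real.sq_sqrt hC.le, Real.sq_sqrt hdisp.le]
    linarith [h.sq_one_sub_deriv_le (Ioo_subset_Icc_self hx)]
  have hdisp_le : C * disp g x ≤ C * √C * √(disp g x) :=
    calc C * disp g x = C * √(disp g x) * √(disp g x) := by
          rw [mul_assoc, Real.mul_self_sqrt hdisp.le]
      _ ≤ C * √C * √(disp g x) := by gcongr
  linarith [(abs_le.1 (h.abs_dispRatio_sub_deriv_le hx)).1]

theorem invSqrtDisp_apply_sub_le (h : ParabolicContraction C L g g' g'') (hx : x ∈ Ioo 0 L) :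
    invSqrtDisp g (g x) - invSqrtDisp g x ≤ (2 + C) * C := by
  have hC := h.const_pos
  have hd : 0 < √(disp g x) := Real.sqrt_pos.2 (h.disp_pos hx)
  have hratio := h.one_le_mul_dispRatio hx
  have hle := h.one_sub_dispRatio_le hx
  rw [h.invSqrtDisp_apply_sub hx]
  set q := disp g (g x) / disp g x
  have hq : 0 < √q := Real.sqrt_pos.2 (pos_of_mul_pos_right (one_pos.trans_le hratio) hC.le)
  have hCq : 1 ≤ √C * √q := by rwa [← Real.sqrt_mul hC.le, Real.one_le_sqrt]
  rw [div_div, div_le_iff₀ (by positivity)]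
  calc 1 - q ≤ (2 + C) * √C * √(disp g x) * 1 := by rwa [mul_one]
    _ ≤ (2 + C) * √C * √(disp g x) * (√C * √q * (1 + √q)) := by
        gcongr
        exact one_le_mul_of_one_le_of_one_le hCq (le_add_of_nonneg_right hq.le)
    _ = (2 + C) * (√C * √C) * (√(disp g x) * (√q * (1 + √q))) := by ring
    _ = (2 + C) * C * (√(disp g x) * (√q * (1 + √q))) := by rw [Real.mul_self_sqrt hC.le]

theorem invSqrtDisp_iterate_le (h : ParabolicContraction C L g g' g'') (hx : x ∈ Ioo 0 L)
    (n : ℕ) : invSqrtDisp g (g^[n] x) ≤ invSqrtDisp g x + n * ((2 + C) * C) := by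
  induction n with
  | zero => rw [Function.iterate_zero_apply, Nat.cast_zero, zero_mul, add_zero]
  | succ n ih =>
    have hstep := h.invSqrtDisp_apply_sub_le (h.iterate_mem hx n)
    rw [Function.iterate_succ_apply', Nat.cast_add_one]
    linarith

theorem inv_iterDeriv_eq (h : ParabolicContraction C L g g' g'') (hx : x ∈ Ioo 0 L) (n : ℕ) :
    (iterDeriv g g' n x)⁻¹ = szekeres L g g' x / szekeres L g g' (g^[n] x) := by
  rw [h.szekeres_iterate hx, div_mul_cancel_right₀ (szekeres_pos hx).ne']

theorem inv_iterDeriv_le_mul_sq (h : ParabolicContraction C L g g' g'') (hx : x ∈ Ioo 0 L)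
    (n : ℕ) : (iterDeriv g g' n x)⁻¹ ≤
      Real.exp (C ^ 2) ^ 2 * (√(disp g x) * invSqrtDisp g (g^[n] x)) ^ 2 := by
  have hn := h.iterate_mem hx n
  have hdisp := h.disp_pos hx
  rw [h.inv_iterDeriv_eq hx, mul_pow, Real.sq_sqrt hdisp.le, h.sq_invSqrtDisp hn,
    div_le_iff₀ (szekeres_pos hn)]
  have hone : 1 ≤ (disp g (g^[n] x))⁻¹ * (Real.exp (C ^ 2) * szekeres L g g' (g^[n] x)) := by
    rw [← div_eq_inv_mul, one_le_div (h.disp_pos hn)]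
    exact h.disp_le_szekeres hn
  calc szekeres L g g' x ≤ Real.exp (C ^ 2) * disp g x * 1 := by
        rw [mul_one]
        exact h.szekeres_le hx
    _ ≤ Real.exp (C ^ 2) * disp g x *
          ((disp g (g^[n] x))⁻¹ * (Real.exp (C ^ 2) * szekeres L g g' (g^[n] x))) := by gcongr
    _ = Real.exp (C ^ 2) ^ 2 * (disp g x * (disp g (g^[n] x))⁻¹) *
          szekeres L g g' (g^[n] x) := by ring

theorem inv_iterDeriv_le (h : ParabolicContraction C L g g' g'') (hx : x ∈ Ioo 0 L) (n : ℕ) :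
    (iterDeriv g g' n x)⁻¹ ≤
      2 * Real.exp (C ^ 2) ^ 2 * (1 + ((2 + C) * C) ^ 2 * (n ^ 2 * disp g x)) := by
  have hdisp := h.disp_pos hx
  have hd : 0 < √(disp g x) := Real.sqrt_pos.2 hdisp
  have hinv : √(disp g x) * invSqrtDisp g x = 1 := mul_inv_cancel₀ hd.ne'
  have hle : √(disp g x) * invSqrtDisp g (g^[n] x) ≤ 1 + n * ((2 + C) * C) * √(disp g x) :=
    calc √(disp g x) * invSqrtDisp g (g^[n] x)
        ≤ √(disp g x) * (invSqrtDisp g x + n * ((2 + C) * C)) :=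
          mul_le_mul_of_nonneg_left (h.invSqrtDisp_iterate_le hx n) hd.le
      _ = 1 + n * ((2 + C) * C) * √(disp g x) := by rw [mul_add, hinv]; ring
  calc (iterDeriv g g' n x)⁻¹
      ≤ Real.exp (C ^ 2) ^ 2 * (√(disp g x) * invSqrtDisp g (g^[n] x)) ^ 2 :=
        h.inv_iterDeriv_le_mul_sq hx n
    _ ≤ Real.exp (C ^ 2) ^ 2 * (1 + n * ((2 + C) * C) * √(disp g x)) ^ 2 := by
        have := mul_nonneg hd.le (invSqrtDisp_nonneg g (g^[n] x))
        gcongr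
    _ ≤ Real.exp (C ^ 2) ^ 2 * (2 * (1 ^ 2 + (n * ((2 + C) * C) * √(disp g x)) ^ 2)) := by
        gcongr
        exact add_sq_le
    _ = 2 * Real.exp (C ^ 2) ^ 2 * (1 + ((2 + C) * C) ^ 2 * (n ^ 2 * disp g x)) := by
        rw [mul_pow _ (√_), Real.sq_sqrt hdisp.le]
        ring

theorem tendsto_iterate_prod (h : ParabolicContraction C L g g' g'') (hx : x ∈ Ioo 0 L) :
    Tendsto (fun p : ℕ × ℝ => g^[p.1] p.2) (atTop ×ˢ 𝓝 x) (𝓝[>] 0) := by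
  obtain ⟨z, hxz, hzL⟩ := exists_between hx.2
  have hz : z ∈ Ioo 0 L := ⟨hx.1.trans hxz, hzL⟩
  have hmem : ∀ᶠ p : ℕ × ℝ in atTop ×ˢ 𝓝 x, p.2 ∈ Ioo 0 z :=
    tendsto_snd.eventually (Ioo_mem_nhds hx.1 hxz)
  have hpos : ∀ᶠ p : ℕ × ℝ in atTop ×ˢ 𝓝 x, 0 < g^[p.1] p.2 := by
    filter_upwards [hmem] with p hp using (h.iterate_mem ⟨hp.1, hp.2.trans hzL⟩ p.1).1
  refine tendsto_nhdsWithin_iff.2 ⟨?_, hpos⟩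
  refine squeeze_zero' (hpos.mono fun _ => le_of_lt) ?_ ((h.tendsto_iterate hz).comp tendsto_fst)
  filter_upwards [hmem] with p hp
    using (h.iterate_lt_iterate ⟨hp.1, hp.2.trans hzL⟩ hz hp.2 p.1).le

theorem continuousAt_invSqrtDisp_iterate (h : ParabolicContraction C L g g' g'')
    (hx : x ∈ Ioo 0 L) (n : ℕ) : ContinuousAt (fun y => invSqrtDisp g (g^[n] y)) x :=
  ContinuousAt.inv₀ (((h.hasDerivAt_disp (h.iterate_mem hx n)).continuousAt.comp
    (h.hasDerivAt_iterate hx n).continuousAt).sqrt)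
    (Real.sqrt_pos.2 (h.disp_pos (h.iterate_mem hx n))).ne'

theorem tendsto_invSqrtDisp_iterate_div (h : ParabolicContraction C L g g' g'')
    (hx : x ∈ Ioo 0 L) :
    Tendsto (fun p : ℕ × ℝ => invSqrtDisp g (g^[p.1] p.2) / p.1) (atTop ×ˢ 𝓝 x)
      (𝓝 (√(-g'' 0 / 2))) := by
  refine tendsto_div_natCast_of_tendsto_sub (u := fun n y => invSqrtDisp g (g^[n] y))
    (fun n => ?_) ?_
  · exact ⟨_, ((h.continuousAt_invSqrtDisp_iterate hx n).abs.eventually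
      (gt_mem_nhds (lt_add_one _))).mono fun _ => le_of_lt⟩
  · simpa only [Function.comp_def, Function.iterate_succ_apply'] using
      h.tendsto_invSqrtDisp_apply_sub.comp (h.tendsto_iterate_prod hx)

/-- As `n` and the base point vary jointly, this is locally uniform convergence. -/
theorem tendsto_inv_iterDeriv_div_sq (h : ParabolicContraction C L g g' g'')
    (hx : x ∈ Ioo 0 L) :
    Tendsto (fun p : ℕ × ℝ => (iterDeriv g g' p.1 p.2)⁻¹ / (p.1 : ℝ) ^ 2) (atTop ×ˢ 𝓝 x)
      (𝓝 (-g'' 0 / 2 * szekeres L g g' x)) := by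
  have hgrowth := (h.tendsto_invSqrtDisp_iterate_div hx).pow 2
  rw [Real.sq_sqrt (by linarith [h.deriv₂_zero_nonpos])] at hgrowth
  have hratio := (h.tendsto_szekeres_div_disp.inv₀ one_ne_zero).comp (h.tendsto_iterate_prod hx)
  have hszekeres : Tendsto (fun p : ℕ × ℝ => szekeres L g g' p.2) (atTop ×ˢ 𝓝 x)
      (𝓝 (szekeres L g g' x)) :=
    (h.hasDerivAt_szekeres hx).continuousAt.tendsto.comp tendsto_snd
  have hlim := (hgrowth.mul hratio).mul hszekeres
  rw [inv_one, mul_one] at hlim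
  refine hlim.congr' ?_
  filter_upwards [tendsto_snd.eventually (Ioo_mem_nhds hx.1 hx.2)] with p hp
  have hdisp := (h.disp_pos (h.iterate_mem hp p.1)).ne'
  have hpos := (szekeres_pos (g := g) (g' := g') (h.iterate_mem hp p.1)).ne'
  rw [Function.comp_apply, h.inv_iterDeriv_eq hp, div_pow, h.sq_invSqrtDisp (h.iterate_mem hp _)]
  field_simp

end ParabolicContraction

theorem secondDeriv_eq (a b : ℝ) (f : ℝ → ℝ) (x : ℝ) :
    secondDeriv a b f x = derivWithin (derivWithin f (Icc a b)) (Icc a b) x := by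
  rw [secondDeriv, iteratedDerivWithin_succ, iteratedDerivWithin_one]

/-- `C` bounds the length of `[a,b]` and, on `[a,b]`, the functions `1 / f'`, `|f''|` and
`|f'' / f'|`. -/
structure IsDistortionBound (a b : ℝ) (f : ℝ → ℝ) (C : ℝ) : Prop where
  sub_le : b - a ≤ C
  one_le : ∀ x ∈ Icc a b, 1 ≤ C * derivWithin f (Icc a b) x
  abs_secondDeriv_le : ∀ x ∈ Icc a b, |secondDeriv a b f x| ≤ C
  abs_secondDeriv_le_mul : ∀ x ∈ Icc a b, |secondDeriv a b f x| ≤ C * derivWithin f (Icc a b) x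

namespace IsC2Diffeo

variable {a b x : ℝ} {f : ℝ → ℝ}

theorem mapsTo (hf : IsC2Diffeo a b f) : MapsTo f (Icc a b) (Icc a b) := hf.bijOn.mapsTo

theorem iterate_mem (hf : IsC2Diffeo a b f) (hx : x ∈ Icc a b) (n : ℕ) : f^[n] x ∈ Icc a b :=
  hf.mapsTo.iterate n hx

theorem invOn (hf : IsC2Diffeo a b f) : InvOn (inverse a b f) f (Icc a b) (Icc a b) :=
  hf.bijOn.invOn_invFunOn

theorem apply_inverse (hf : IsC2Diffeo a b f) (hx : x ∈ Icc a b) : f (inverse a b f x) = x :=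
  hf.invOn.2 hx

theorem inverse_apply (hf : IsC2Diffeo a b f) (hx : x ∈ Icc a b) : inverse a b f (f x) = x :=
  hf.invOn.1 hx

theorem bijOn_inverse (hf : IsC2Diffeo a b f) : BijOn (inverse a b f) (Icc a b) (Icc a b) :=
  (bijOn_comm hf.invOn).2 hf.bijOn

theorem strictMonoOn (hf : IsC2Diffeo a b f) : StrictMonoOn f (Icc a b) :=
  hf.monotoneOn.strictMonoOn_of_injOn hf.bijOn.injOn

theorem eqOn_inverse_inverse (hf : IsC2Diffeo a b f) :
    EqOn (inverse a b (inverse a b f)) f (Icc a b) := fun x hx => by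
  have hmem : inverse a b (inverse a b f) x ∈ Icc a b :=
    hf.bijOn_inverse.surjOn.mapsTo_invFunOn hx
  have hinv : inverse a b f (inverse a b (inverse a b f) x) = x :=
    hf.bijOn_inverse.invOn_invFunOn.2 hx
  rw [← hf.apply_inverse hmem, hinv]

theorem symm (hf : IsC2Diffeo a b f) : IsC2Diffeo a b (inverse a b f) where
  bijOn := hf.bijOn_inverse
  monotoneOn :=
    Function.monotoneOn_of_rightInvOn_of_mapsTo hf.monotoneOn hf.invOn.2 hf.bijOn_inverse.mapsTo
  contDiffOn := hf.contDiffOn_inverse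
  contDiffOn_inverse := hf.contDiffOn.congr hf.eqOn_inverse_inverse

theorem inverse_eq_self_iff (hf : IsC2Diffeo a b f) (hx : x ∈ Icc a b) :
    inverse a b f x = x ↔ f x = x := by
  constructor <;> intro hfix
  · simpa only [hfix] using hf.apply_inverse hx
  · simpa only [hfix] using hf.inverse_apply hx

theorem left_fixed (hf : IsC2Diffeo a b f) (hab : a ≤ b) : f a = a := by
  have ha : a ∈ Icc a b := left_mem_Icc.2 hab
  obtain ⟨x, hx, hxa⟩ := hf.bijOn.surjOn ha
  exact le_antisymm ((hf.monotoneOn ha hx hx.1).trans hxa.le) (hf.mapsTo ha).1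

theorem right_fixed (hf : IsC2Diffeo a b f) (hab : a ≤ b) : f b = b := by
  have hb : b ∈ Icc a b := right_mem_Icc.2 hab
  obtain ⟨x, hx, hxb⟩ := hf.bijOn.surjOn hb
  exact le_antisymm (hf.mapsTo hb).2 (hxb.ge.trans (hf.monotoneOn hx hb hx.2))

theorem hasDerivWithinAt (hf : IsC2Diffeo a b f) (hx : x ∈ Icc a b) :
    HasDerivWithinAt f (derivWithin f (Icc a b) x) (Icc a b) x :=
  (hf.contDiffOn.differentiableOn two_ne_zero x hx).hasDerivWithinAt

theorem contDiffOn_derivWithin (hf : IsC2Diffeo a b f) (hab : a < b) :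
    ContDiffOn ℝ 1 (derivWithin f (Icc a b)) (Icc a b) :=
  hf.contDiffOn.derivWithin (uniqueDiffOn_Icc hab) one_add_one_eq_two.le

theorem hasDerivWithinAt_derivWithin (hf : IsC2Diffeo a b f) (hab : a < b) (hx : x ∈ Icc a b) :
    HasDerivWithinAt (derivWithin f (Icc a b)) (secondDeriv a b f x) (Icc a b) x := by
  rw [secondDeriv_eq]
  exact ((hf.contDiffOn_derivWithin hab).differentiableOn one_ne_zero x hx).hasDerivWithinAt

theorem continuousOn_secondDeriv (hf : IsC2Diffeo a b f) (hab : a < b) :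
    ContinuousOn (secondDeriv a b f) (Icc a b) :=
  hf.contDiffOn.continuousOn_iteratedDerivWithin le_rfl (uniqueDiffOn_Icc hab)

theorem derivWithin_inverse_mul (hf : IsC2Diffeo a b f) (hab : a < b) (hx : x ∈ Icc a b) :
    derivWithin (inverse a b f) (Icc a b) (f x) * derivWithin f (Icc a b) x = 1 := by
  have hchain := (hf.symm.hasDerivWithinAt (hf.mapsTo hx)).comp x (hf.hasDerivWithinAt hx) hf.mapsTo
  have hid : HasDerivWithinAt (inverse a b f ∘ f) 1 (Icc a b) x :=
    (hasDerivWithinAt_id x _).congr hf.invOn.1 (hf.inverse_apply hx)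
  exact (uniqueDiffOn_Icc hab x hx).eq_deriv _ hchain hid

theorem derivWithin_pos (hf : IsC2Diffeo a b f) (hab : a < b) (hx : x ∈ Icc a b) :
    0 < derivWithin f (Icc a b) x :=
  hf.monotoneOn.derivWithin_nonneg.lt_of_ne'
    (right_ne_zero_of_mul_eq_one (hf.derivWithin_inverse_mul hab hx))

theorem hasDerivWithinAt_iterate (hf : IsC2Diffeo a b f) (hx : x ∈ Icc a b) (n : ℕ) :
    HasDerivWithinAt (f^[n]) (iterDeriv f (derivWithin f (Icc a b)) n x) (Icc a b) x := by
  induction n with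
  | zero => exact (hasDerivWithinAt_id x _).congr_deriv (iterDeriv_zero _ _ _).symm
  | succ n ih =>
    rw [Function.iterate_succ', iterDeriv_succ, mul_comm]
    exact (hf.hasDerivWithinAt (hf.iterate_mem hx n)).comp x ih (hf.mapsTo.iterate n)

theorem derivWithin_iterate (hf : IsC2Diffeo a b f) (hab : a < b) (hx : x ∈ Icc a b) (n : ℕ) :
    derivWithin (f^[n]) (Icc a b) x = iterDeriv f (derivWithin f (Icc a b)) n x :=
  (hf.hasDerivWithinAt_iterate hx n).derivWithin (uniqueDiffOn_Icc hab x hx)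

theorem continuousOn_derivWithin_iterate (hf : IsC2Diffeo a b f) (hab : a < b) (n : ℕ) :
    ContinuousOn (derivWithin (f^[n]) (Icc a b)) (Icc a b) := by
  have hcont : ContinuousOn (iterDeriv f (derivWithin f (Icc a b)) n) (Icc a b) :=
    continuousOn_finsetProd _ fun i _ =>
      (hf.contDiffOn_derivWithin hab).continuousOn.comp
        (fun x hx => (hf.hasDerivWithinAt_iterate hx i).continuousWithinAt) (hf.mapsTo.iterate i)
  exact hcont.congr fun x hx => hf.derivWithin_iterate hab hx n

theorem iterate_inverse_iterate (hf : IsC2Diffeo a b f) (hx : x ∈ Icc a b) (n : ℕ) :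
    f^[n] ((inverse a b f)^[n] x) = x := by
  induction n with
  | zero => rfl
  | succ n ih =>
    rw [Function.iterate_succ_apply, Function.iterate_succ_apply',
      hf.apply_inverse (hf.symm.iterate_mem hx n), ih]

theorem inverse_iterate_iterate (hf : IsC2Diffeo a b f) (hx : x ∈ Icc a b) (n : ℕ) :
    (inverse a b f)^[n] (f^[n] x) = x := by
  induction n with
  | zero => rfl
  | succ n ih =>
    rw [Function.iterate_succ_apply, Function.iterate_succ_apply',
      hf.inverse_apply (hf.iterate_mem hx n), ih]

theorem derivWithin_iterate_eq_inv (hf : IsC2Diffeo a b f) (hab : a < b) (hx : x ∈ Icc a b)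
    (n : ℕ) :
    derivWithin (f^[n]) (Icc a b) x =
      (iterDeriv (inverse a b f) (derivWithin (inverse a b f) (Icc a b)) n (f^[n] x))⁻¹ := by
  have hchain := (hf.symm.hasDerivWithinAt_iterate (hf.iterate_mem hx n) n).comp x
    (hf.hasDerivWithinAt_iterate hx n) (hf.mapsTo.iterate n)
  have hid : HasDerivWithinAt ((inverse a b f)^[n] ∘ f^[n]) 1 (Icc a b) x :=
    (hasDerivWithinAt_id x _).congr (fun y hy => hf.inverse_iterate_iterate hy n)
      (hf.inverse_iterate_iterate hx n)
  rw [hf.derivWithin_iterate hab hx]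
  exact eq_inv_of_mul_eq_one_right ((uniqueDiffOn_Icc hab x hx).eq_deriv _ hchain hid)

theorem onlyParabolicFixedPoints_inverse (hf : IsC2Diffeo a b f) (hab : a < b)
    (hpar : OnlyParabolicFixedPoints a b f) :
    OnlyParabolicFixedPoints a b (inverse a b f) := fun x hx hfix => by
  have hfx := (hf.inverse_eq_self_iff hx).1 hfix
  have hmul := hf.derivWithin_inverse_mul hab hx
  rwa [hfx, hpar x hx hfx, mul_one] at hmul

theorem secondDeriv_inverse_of_fixed (hf : IsC2Diffeo a b f) (hab : a < b)
    (hpar : OnlyParabolicFixedPoints a b f) (hx : x ∈ Icc a b) (hfx : f x = x) :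
    secondDeriv a b (inverse a b f) x = -secondDeriv a b f x := by
  have hinv : HasDerivWithinAt (derivWithin (inverse a b f) (Icc a b))
      (secondDeriv a b (inverse a b f) x) (Icc a b) (f x) := by
    rw [hfx]
    exact hf.symm.hasDerivWithinAt_derivWithin hab hx
  have hleibniz := (hinv.comp x (hf.hasDerivWithinAt hx) hf.mapsTo).mul
    (hf.hasDerivWithinAt_derivWithin hab hx)
  have hconst : HasDerivWithinAt ((derivWithin (inverse a b f) (Icc a b) ∘ f) *
      derivWithin f (Icc a b)) 0 (Icc a b) x :=
    (hasDerivWithinAt_const x _ (1 : ℝ)).congr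
      (fun y hy => hf.derivWithin_inverse_mul hab hy) (hf.derivWithin_inverse_mul hab hx)
  have hsum := (uniqueDiffOn_Icc hab x hx).eq_deriv _ hleibniz hconst
  rw [Function.comp_apply, hfx, hpar x hx hfx, hf.onlyParabolicFixedPoints_inverse hab hpar x hx
    ((hf.inverse_eq_self_iff hx).2 hfx)] at hsum
  linarith

theorem exists_isDistortionBound (hf : IsC2Diffeo a b f) (hab : a < b) :
    ∃ C, IsDistortionBound a b f C := by
  obtain ⟨B, hB⟩ := isCompact_Icc.exists_bound_of_continuousOn (hf.continuousOn_secondDeriv hab)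
  obtain ⟨z, hz, hmin⟩ := isCompact_Icc.exists_isMinOn (nonempty_Icc.2 hab.le)
    (hf.contDiffOn_derivWithin hab).continuousOn
  have hm := hf.derivWithin_pos hab hz
  set m := derivWithin f (Icc a b) z
  set C := max (b - a) (max B (max (1 / m) (B / m)))
  have hC : 0 ≤ C := (sub_pos.2 hab).le.trans (le_max_left _ _)
  have hmul : ∀ {t}, t / m ≤ C → ∀ x ∈ Icc a b, t ≤ C * derivWithin f (Icc a b) x :=
    fun ht x hx => ((div_le_iff₀ hm).1 ht).trans (mul_le_mul_of_nonneg_left (hmin hx) hC)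
  exact ⟨C,
    { sub_le := le_max_left _ _
      one_le := hmul (by simp only [C, le_max_iff, le_refl, true_or, or_true])
      abs_secondDeriv_le := fun x hx =>
        (hB x hx).trans (by simp only [C, le_max_iff, le_refl, true_or, or_true])
      abs_secondDeriv_le_mul := fun x hx => (hB x hx).trans
        (hmul (by simp only [C, le_max_iff, le_refl, or_true]) x hx) }⟩

theorem isCompact_setOf_fixed (hf : IsC2Diffeo a b f) {u v : ℝ} (huv : Icc u v ⊆ Icc a b) :
    IsCompact {y ∈ Icc u v | f y = y} :=
  isCompact_Icc.of_isClosed_subset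
    (isClosed_Icc.isClosed_eq (hf.contDiffOn.continuousOn.mono huv) continuousOn_id)
    (sep_subset _ _)

theorem exists_isComponent (hf : IsC2Diffeo a b f) (hx : x ∈ Icc a b) (hfx : f x ≠ x) :
    ∃ c d, IsComponent a b f c d ∧ x ∈ Ioo c d := by
  have hab : a ≤ b := hx.1.trans hx.2
  obtain ⟨c, hc, hcmax⟩ := (hf.isCompact_setOf_fixed
    (Icc_subset_Icc_right hx.2)).exists_isGreatest ⟨a, left_mem_Icc.2 hx.1, hf.left_fixed hab⟩
  obtain ⟨d, hd, hdmin⟩ := (hf.isCompact_setOf_fixed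
    (Icc_subset_Icc_left hx.1)).exists_isLeast ⟨b, right_mem_Icc.2 hx.2, hf.right_fixed hab⟩
  have hcx : c < x := hc.1.2.lt_of_ne fun he => hfx (he ▸ hc.2)
  have hxd : x < d := hd.1.1.lt_of_ne fun he => hfx (he ▸ hd.2)
  refine ⟨c, d, ⟨hcx.trans hxd, Icc_subset_Icc hc.1.1 hd.1.2, hc.2, hd.2, fun y hy hfy => ?_⟩,
    hcx, hxd⟩
  rcases le_total y x with hyx | hxy
  · exact hy.1.not_ge (hcmax ⟨⟨hc.1.1.trans hy.1.le, hyx⟩, hfy⟩)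
  · exact hy.2.not_ge (hdmin ⟨⟨hxy, hy.2.le.trans hd.1.2⟩, hfy⟩)

end IsC2Diffeo

/-- The map `f` in the coordinate `s = σ (x - p)`, for `σ = ±1`. -/
def chart (p σ : ℝ) (f : ℝ → ℝ) (s : ℝ) : ℝ := σ * (f (p + σ * s) - p)

section Chart

variable {p σ s : ℝ} {f : ℝ → ℝ} {S T : Set ℝ}

theorem add_mul_mul_sub (hσ : σ * σ = 1) (p y : ℝ) : p + σ * (σ * (y - p)) = y := by
  linear_combination (y - p) * hσ

theorem add_mul_chart (hσ : σ * σ = 1) (p : ℝ) (f : ℝ → ℝ) (s : ℝ) :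
    p + σ * chart p σ f s = f (p + σ * s) :=
  add_mul_mul_sub hσ p _

theorem chart_eq_self (hσ : σ * σ = 1) (hs : f (p + σ * s) = p + σ * s) : chart p σ f s = s := by
  rw [chart, hs]
  linear_combination s * hσ

theorem chart_chart (hσ : σ * σ = 1) (p : ℝ) (f : ℝ → ℝ) :
    chart (-(σ * p)) σ (chart p σ f) = f := by
  funext x
  have hx : p + σ * (-(σ * p) + σ * x) = x := by linear_combination (x - p) * hσ
  rw [chart, chart, hx]
  linear_combination f x * hσ

theorem disp_chart (hσ : σ * σ = 1) (p : ℝ) (f : ℝ → ℝ) (s : ℝ) :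
    disp (chart p σ f) s = σ * disp f (p + σ * s) := by
  rw [disp, disp, chart]
  linear_combination -s * hσ

theorem iterDeriv_add_mul (hσ : σ * σ = 1) (p : ℝ) (f f' : ℝ → ℝ) (n : ℕ) (s : ℝ) :
    iterDeriv f f' n (p + σ * s) = iterDeriv (chart p σ f) (fun t => f' (p + σ * t)) n s := by
  have hsemiconj : Function.Semiconj (fun t => p + σ * t) (chart p σ f) f := add_mul_chart hσ p f
  exact Finset.prod_congr rfl fun i _ => congrArg f' (hsemiconj.iterate_right i s).symm

theorem strictMonoOn_chart (hσ : σ * σ = 1) (hf : StrictMonoOn f S)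
    (hT : MapsTo (fun t => p + σ * t) T S) : StrictMonoOn (chart p σ f) T := by
  intro s hs t ht hst
  rcases mul_self_eq_one_iff.1 hσ with rfl | rfl
  · have hlt := hf (hT hs) (hT ht) (by linarith)
    simp only [chart]
    linarith
  · have hlt := hf (hT ht) (hT hs) (by linarith)
    simp only [chart]
    linarith

theorem hasDerivWithinAt_comp_add_mul {m : ℝ} (hf : HasDerivWithinAt f m S (p + σ * s))
    (hT : MapsTo (fun t => p + σ * t) T S) :
    HasDerivWithinAt (fun t => f (p + σ * t)) (σ * m) T s := by
  have haff : HasDerivWithinAt (fun t => p + σ * t) σ T s :=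
    (((hasDerivWithinAt_id s T).const_mul σ).const_add p).congr_deriv (mul_one σ)
  exact (hf.comp s haff hT).congr_deriv (mul_comm _ _)

theorem hasDerivWithinAt_chart (hσ : σ * σ = 1) {m : ℝ}
    (hf : HasDerivWithinAt f m S (p + σ * s)) (hT : MapsTo (fun t => p + σ * t) T S) :
    HasDerivWithinAt (chart p σ f) m T s :=
  (((hasDerivWithinAt_comp_add_mul hf hT).sub_const p).const_mul σ).congr_deriv
    (by rw [← mul_assoc, hσ, one_mul])

theorem IsTimeOneMap.comp_add_mul {X : ℝ → ℝ} (hX : IsTimeOneMap X S f) (hσ : σ * σ = 1)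
    (hS : ∀ s, s ∈ T ↔ p + σ * s ∈ S) :
    IsTimeOneMap (fun s => σ * X (p + σ * s)) T (chart p σ f) := by
  intro s hs
  obtain ⟨φ, hφ₀, hφ₁, hφ_mem, hφ⟩ := hX _ ((hS s).1 hs)
  refine ⟨fun t => σ * (φ t - p), ?_, ?_, fun t ht => ?_, fun t ht => ?_⟩
  · simp only [hφ₀]
    rw [add_sub_cancel_left, ← mul_assoc, hσ, one_mul]
  · simp only [hφ₁, chart]
  · rw [hS, add_mul_mul_sub hσ]
    exact hφ_mem t ht
  · simp only [add_mul_mul_sub hσ]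
    exact ((hφ t ht).sub_const p).const_mul σ

end Chart

/-- A component `[c, d]` with repelling endpoint `p`, where `σ` is the direction from `p` into the
component. -/
structure OrientedComponent (a b : ℝ) (f : ℝ → ℝ) (c d p σ : ℝ) : Prop where
  isComponent : IsComponent a b f c d
  endpoint : (σ = 1 ∧ p = c) ∨ (σ = -1 ∧ p = d)
  pos : ∀ x ∈ Ioo c d, 0 < σ * (f x - x)

namespace IsComponent

variable {a b c d : ℝ} {f : ℝ → ℝ}

theorem left_mem (h : IsComponent a b f c d) : c ∈ Icc a b := h.subset (left_mem_Icc.2 h.lt.le)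

theorem right_mem (h : IsComponent a b f c d) : d ∈ Icc a b := h.subset (right_mem_Icc.2 h.lt.le)

theorem mapsTo_Ioo (h : IsComponent a b f c d) (hf : IsC2Diffeo a b f) :
    MapsTo f (Ioo c d) (Ioo c d) := by
  simpa only [h.fixed_left, h.fixed_right] using (hf.strictMonoOn.mono h.subset).mapsTo_Ioo

theorem symm (h : IsComponent a b f c d) (hf : IsC2Diffeo a b f) :
    IsComponent a b (inverse a b f) c d where
  lt := h.lt
  subset := h.subset
  fixed_left := (hf.inverse_eq_self_iff h.left_mem).2 h.fixed_left
  fixed_right := (hf.inverse_eq_self_iff h.right_mem).2 h.fixed_right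
  ne_of_mem_interior x hx hfix := h.ne_of_mem_interior x hx
    ((hf.inverse_eq_self_iff (h.subset (Ioo_subset_Icc_self hx))).1 hfix)

theorem exists_orientedComponent (h : IsComponent a b f c d) (hf : IsC2Diffeo a b f) :
    ∃ p σ, OrientedComponent a b f c d p σ := by
  have hcont : ContinuousOn (fun x => f x - x) (Ioo c d) :=
    (hf.contDiffOn.continuousOn.mono (Ioo_subset_Icc_self.trans h.subset)).sub continuousOn_id
  by_cases hright : ∀ x ∈ Ioo c d, x < f x
  · exact ⟨c, 1, h, Or.inl ⟨rfl, rfl⟩, fun x hx => by linarith [hright x hx]⟩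
  push Not at hright
  obtain ⟨x, hx, hfx⟩ := hright
  refine ⟨d, -1, h, Or.inr ⟨rfl, rfl⟩, fun y hy => ?_⟩
  by_contra hle
  obtain ⟨z, hz, hfz⟩ := isPreconnected_Ioo.intermediate_value hx hy hcont
    ⟨sub_nonpos.2 hfx, show 0 ≤ f y - y by linarith⟩
  exact h.ne_of_mem_interior z hz (sub_eq_zero.1 hfz)

end IsComponent

namespace IsRepellingEndpoint

variable {a b c d r : ℝ} {f : ℝ → ℝ}

theorem mem_Icc (hr : IsRepellingEndpoint f c d r) (h : IsComponent a b f c d) :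
    r ∈ Icc a b := by
  rcases hr.1 with rfl | rfl
  · exact h.left_mem
  · exact h.right_mem

theorem fixed (hr : IsRepellingEndpoint f c d r) (h : IsComponent a b f c d) : f r = r := by
  rcases hr.1 with rfl | rfl
  · exact h.fixed_left
  · exact h.fixed_right

end IsRepellingEndpoint

namespace OrientedComponent

variable {a b c d p σ : ℝ} {f : ℝ → ℝ}

theorem mul_self (h : OrientedComponent a b f c d p σ) : σ * σ = 1 :=
  mul_self_eq_one_iff.2 (h.endpoint.imp And.left And.left)

theorem abs_eq_one (h : OrientedComponent a b f c d p σ) : |σ| = 1 :=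
  (abs_eq zero_le_one).2 (h.endpoint.imp And.left And.left)

theorem mem_Icc_iff (h : OrientedComponent a b f c d p σ) (s : ℝ) :
    s ∈ Icc 0 (d - c) ↔ p + σ * s ∈ Icc c d := by
  rcases h.endpoint with ⟨rfl, rfl⟩ | ⟨rfl, rfl⟩ <;> constructor <;> rintro ⟨hl, hr⟩ <;>
    constructor <;> linarith

theorem mem_Ioo_iff (h : OrientedComponent a b f c d p σ) (s : ℝ) :
    s ∈ Ioo 0 (d - c) ↔ p + σ * s ∈ Ioo c d := by
  rcases h.endpoint with ⟨rfl, rfl⟩ | ⟨rfl, rfl⟩ <;> constructor <;> rintro ⟨hl, hr⟩ <;>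
    constructor <;> linarith

theorem mem_Ico_iff (h : OrientedComponent a b f c d p σ) (s : ℝ) :
    s ∈ Ico 0 (d - c) ↔ p + σ * s ∈ halfClosed c d p := by
  have hσ : σ ≠ 0 := left_ne_zero_of_mul_eq_one h.mul_self
  rw [halfClosed, mem_union, ← h.mem_Ioo_iff, mem_singleton_iff, add_eq_left, mul_eq_zero,
    or_iff_right hσ, or_comm, ← mem_singleton_iff, ← mem_union, singleton_union,
    Ioo_insert_left (sub_pos.2 h.isComponent.lt)]

theorem mul_sub_mem_Icc_iff (h : OrientedComponent a b f c d p σ) {x : ℝ} :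
    σ * (x - p) ∈ Icc 0 (d - c) ↔ x ∈ Icc c d := by
  rw [h.mem_Icc_iff, add_mul_mul_sub h.mul_self]

theorem mul_sub_mem_Ioo_iff (h : OrientedComponent a b f c d p σ) {x : ℝ} :
    σ * (x - p) ∈ Ioo 0 (d - c) ↔ x ∈ Ioo c d := by
  rw [h.mem_Ioo_iff, add_mul_mul_sub h.mul_self]

theorem mul_sub_mem_Ico_iff (h : OrientedComponent a b f c d p σ) {x : ℝ} :
    σ * (x - p) ∈ Ico 0 (d - c) ↔ x ∈ halfClosed c d p := by
  rw [h.mem_Ico_iff, add_mul_mul_sub h.mul_self]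

theorem isRepellingEndpoint (h : OrientedComponent a b f c d p σ) :
    IsRepellingEndpoint f c d p := by
  refine ⟨h.endpoint.imp And.right And.right, fun x hx => ?_⟩
  have hpos := h.pos x hx
  rcases h.endpoint with ⟨rfl, rfl⟩ | ⟨rfl, rfl⟩
  · rw [abs_of_pos (by linarith [hx.1]), abs_of_pos (by linarith [hx.1])]
    linarith
  · rw [abs_of_neg (by linarith [hx.2]), abs_of_neg (by linarith [hx.2])]
    linarith

theorem eq_of_isRepellingEndpoint (h : OrientedComponent a b f c d p σ) (hf : IsC2Diffeo a b f)
    {r : ℝ} (hr : IsRepellingEndpoint f c d r) : r = p := by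
  obtain ⟨x, hx⟩ := nonempty_Ioo.2 h.isComponent.lt
  have hpos := h.pos x hx
  have hlt := hr.2 x hx
  have hfx := h.isComponent.mapsTo_Ioo hf hx
  rcases h.endpoint with ⟨rfl, rfl⟩ | ⟨rfl, rfl⟩ <;> rcases hr.1 with rfl | rfl
  · rfl
  · rw [abs_of_neg (by linarith [hx.2]), abs_of_neg (by linarith [hfx.2])] at hlt
    linarith
  · rw [abs_of_pos (by linarith [hx.1]), abs_of_pos (by linarith [hfx.1])] at hlt
    linarith
  · rfl

theorem mapsTo_Icc (h : OrientedComponent a b f c d p σ) :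
    MapsTo (fun s => p + σ * s) (Icc 0 (d - c)) (Icc a b) :=
  fun s hs => h.isComponent.subset ((h.mem_Icc_iff s).1 hs)

theorem mem_Icc (h : OrientedComponent a b f c d p σ) : p ∈ Icc a b :=
  h.isRepellingEndpoint.mem_Icc h.isComponent

theorem fixed (h : OrientedComponent a b f c d p σ) : f p = p :=
  h.isRepellingEndpoint.fixed h.isComponent

theorem inverse_fixed (h : OrientedComponent a b f c d p σ) (hf : IsC2Diffeo a b f) :
    inverse a b f (p + σ * 0) = p + σ * 0 := by
  rw [mul_zero, add_zero]
  exact (hf.inverse_eq_self_iff h.mem_Icc).2 h.fixed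

theorem inverse_fixed_right (h : OrientedComponent a b f c d p σ) (hf : IsC2Diffeo a b f) :
    inverse a b f (p + σ * (d - c)) = p + σ * (d - c) := by
  rcases h.endpoint with ⟨rfl, rfl⟩ | ⟨rfl, rfl⟩
  · rw [one_mul, add_sub_cancel, (h.isComponent.symm hf).fixed_right]
  · rw [neg_one_mul, neg_sub, add_sub_cancel, (h.isComponent.symm hf).fixed_left]

theorem intervalContraction (h : OrientedComponent a b f c d p σ) (hf : IsC2Diffeo a b f) :
    IntervalContraction (d - c) (chart p σ (inverse a b f)) where
  pos := sub_pos.2 h.isComponent.lt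
  map_zero := chart_eq_self h.mul_self (h.inverse_fixed hf)
  map_right := chart_eq_self h.mul_self (h.inverse_fixed_right hf)
  lt_self s hs := by
    have hpos := h.pos _ ((h.isComponent.symm hf).mapsTo_Ioo hf.symm ((h.mem_Ioo_iff s).1 hs))
    rw [hf.apply_inverse (h.mapsTo_Icc (Ioo_subset_Icc_self hs))] at hpos
    rw [← sub_pos, ← disp, disp_chart h.mul_self]
    exact hpos
  continuousOn := fun s hs => (hasDerivWithinAt_chart h.mul_self
    (hf.symm.hasDerivWithinAt (h.mapsTo_Icc hs)) h.mapsTo_Icc).continuousWithinAt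
  strictMonoOn := strictMonoOn_chart h.mul_self hf.symm.strictMonoOn h.mapsTo_Icc

theorem parabolicContraction (h : OrientedComponent a b f c d p σ) (hab : a < b)
    (hf : IsC2Diffeo a b f) (hpar : OnlyParabolicFixedPoints a b f) {C : ℝ}
    (hC : IsDistortionBound a b (inverse a b f) C) :
    ParabolicContraction C (d - c) (chart p σ (inverse a b f))
      (fun s => derivWithin (inverse a b f) (Icc a b) (p + σ * s))
      (fun s => σ * secondDeriv a b (inverse a b f) (p + σ * s)) where
  toIntervalContraction := h.intervalContraction hf
  le := (sub_le_sub h.isComponent.right_mem.2 h.isComponent.left_mem.1).trans hC.sub_le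
  hasDerivWithinAt s hs := hasDerivWithinAt_chart h.mul_self
    (hf.symm.hasDerivWithinAt (h.mapsTo_Icc hs)) h.mapsTo_Icc
  hasDerivWithinAt_deriv s hs := hasDerivWithinAt_comp_add_mul
    (hf.symm.hasDerivWithinAt_derivWithin hab (h.mapsTo_Icc hs)) h.mapsTo_Icc
  continuousOn_deriv₂ := continuousOn_const.mul
    ((hf.symm.continuousOn_secondDeriv hab).comp (by fun_prop) h.mapsTo_Icc)
  deriv_zero := hf.onlyParabolicFixedPoints_inverse hab hpar _
    (h.mapsTo_Icc (left_mem_Icc.2 (sub_nonneg.2 h.isComponent.lt.le))) (h.inverse_fixed hf)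
  deriv_right := hf.onlyParabolicFixedPoints_inverse hab hpar _
    (h.mapsTo_Icc (right_mem_Icc.2 (sub_nonneg.2 h.isComponent.lt.le))) (h.inverse_fixed_right hf)
  one_le s hs := hC.one_le _ (h.mapsTo_Icc hs)
  abs_deriv₂_le s hs := by
    rw [abs_mul, h.abs_eq_one, one_mul]
    exact hC.abs_secondDeriv_le _ (h.mapsTo_Icc hs)
  abs_deriv₂_le_mul s hs := by
    rw [abs_mul, h.abs_eq_one, one_mul]
    exact hC.abs_secondDeriv_le_mul _ (h.mapsTo_Icc hs)

theorem isRightInverseOn (h : OrientedComponent a b f c d p σ) (hf : IsC2Diffeo a b f) :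
    IsRightInverseOn (d - c) (chart p σ (inverse a b f)) (chart p σ f) where
  map_zero := chart_eq_self h.mul_self (by rw [mul_zero, add_zero, h.fixed])
  mapsTo s hs := by
    rw [h.mem_Ioo_iff, add_mul_chart h.mul_self]
    exact h.isComponent.mapsTo_Ioo hf ((h.mem_Ioo_iff s).1 hs)
  apply s hs := by
    rw [chart, add_mul_chart h.mul_self, hf.inverse_apply (h.mapsTo_Icc (Ioo_subset_Icc_self hs)),
      add_sub_cancel_left, ← mul_assoc, h.mul_self, one_mul]

/-- The Szekeres vector field on a component. It is obtained in the chart from the inverse of `f`,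
which contracts the component towards its repelling endpoint. -/
noncomputable def field (a b : ℝ) (f : ℝ → ℝ) (c d p σ : ℝ) (x : ℝ) : ℝ :=
  σ * szekeres (d - c) (chart p σ (inverse a b f))
    (fun s => derivWithin (inverse a b f) (Icc a b) (p + σ * s)) (σ * (x - p))

theorem isTimeOneMap_field (h : OrientedComponent a b f c d p σ) (hab : a < b)
    (hf : IsC2Diffeo a b f) (hpar : OnlyParabolicFixedPoints a b f) :
    IsTimeOneMap (field a b f c d p σ) (halfClosed c d p) f := by
  obtain ⟨C, hC⟩ := hf.symm.exists_isDistortionBound hab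
  have hcoord : ∀ x, σ * (x - p) = -(σ * p) + σ * x := fun x => by ring
  have hflow := ((h.parabolicContraction hab hf hpar hC).isTimeOneMap_szekeres
    (h.isRightInverseOn hf)).comp_add_mul (T := halfClosed c d p) (p := -(σ * p)) h.mul_self
    fun x => by rw [← hcoord, h.mul_sub_mem_Ico_iff]
  rw [chart_chart h.mul_self] at hflow
  unfold field
  simpa only [hcoord] using hflow

theorem isSzekeresField_field (h : OrientedComponent a b f c d p σ) (hab : a < b)
    (hf : IsC2Diffeo a b f) (hpar : OnlyParabolicFixedPoints a b f) :
    IsSzekeresField f c d p (field a b f c d p σ) := by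
  obtain ⟨C, hC⟩ := hf.symm.exists_isDistortionBound hab
  refine ⟨contDiffOn_const.mul ?_, h.isTimeOneMap_field hab hf hpar⟩
  exact (h.parabolicContraction hab hf hpar hC).contDiffOn_szekeres.comp (by fun_prop)
    fun x hx => h.mul_sub_mem_Ico_iff.2 hx

theorem continuousOn_field (h : OrientedComponent a b f c d p σ) (hab : a < b)
    (hf : IsC2Diffeo a b f) (hpar : OnlyParabolicFixedPoints a b f) :
    ContinuousOn (field a b f c d p σ) (Icc c d) := by
  obtain ⟨C, hC⟩ := hf.symm.exists_isDistortionBound hab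
  exact continuousOn_const.mul ((h.parabolicContraction hab hf hpar hC).continuousOn_szekeres.comp
    (by fun_prop) fun x hx => h.mul_sub_mem_Icc_iff.2 hx)

theorem eqOn_field (h : OrientedComponent a b f c d p σ) (hab : a < b)
    (hf : IsC2Diffeo a b f) (hpar : OnlyParabolicFixedPoints a b f) {Y : ℝ → ℝ}
    (hY : IsSzekeresField f c d p Y) : EqOn Y (field a b f c d p σ) (halfClosed c d p) := by
  obtain ⟨C, hC⟩ := hf.symm.exists_isDistortionBound hab
  intro x hx
  have heq := (h.parabolicContraction hab hf hpar hC).eqOn_szekeres (h.isRightInverseOn hf)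
    (contDiffOn_const.mul (hY.contDiffOn.comp (by fun_prop) fun s hs => (h.mem_Ico_iff s).1 hs))
    (hY.isTimeOneMap.comp_add_mul h.mul_self h.mem_Ico_iff) (h.mul_sub_mem_Ico_iff.2 hx)
  simp only [Function.comp_apply, add_mul_mul_sub h.mul_self] at heq
  rw [field, ← heq, ← mul_assoc, h.mul_self, one_mul]

theorem eqOn_field_Icc (h : OrientedComponent a b f c d p σ) (hab : a < b)
    (hf : IsC2Diffeo a b f) (hpar : OnlyParabolicFixedPoints a b f) {Y : ℝ → ℝ}
    (hY : IsSzekeresField f c d p Y) (hYc : ContinuousOn Y (Icc c d)) :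
    EqOn Y (field a b f c d p σ) (Icc c d) :=
  ((h.eqOn_field hab hf hpar hY).mono subset_union_left).of_subset_closure hYc
    (h.continuousOn_field hab hf hpar) Ioo_subset_Icc_self (closure_Ioo h.isComponent.lt.ne).ge

theorem abs_field (h : OrientedComponent a b f c d p σ) (x : ℝ) :
    |field a b f c d p σ x| = szekeres (d - c) (chart p σ (inverse a b f))
      (fun s => derivWithin (inverse a b f) (Icc a b) (p + σ * s)) (σ * (x - p)) := by
  rw [field, abs_mul, h.abs_eq_one, one_mul, abs_of_nonneg (szekeres_nonneg _)]

theorem field_eq_zero (h : OrientedComponent a b f c d p σ) {x : ℝ} (hx : x ∉ Ioo c d) :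
    field a b f c d p σ x = 0 := by
  rw [field, szekeres, indicator_of_notMem (mt h.mul_sub_mem_Ioo_iff.1 hx), mul_zero]

theorem field_ne_zero (h : OrientedComponent a b f c d p σ) {x : ℝ} (hx : x ∈ Ioo c d) :
    field a b f c d p σ x ≠ 0 := by
  rw [← abs_pos, h.abs_field]
  exact szekeres_pos (h.mul_sub_mem_Ioo_iff.2 hx)

end OrientedComponent

theorem eventually_forall_mem_of_isCompact {ι X : Type*} [TopologicalSpace X] {l : Filter ι}
    {K : Set X} {P : ι → X → Prop} (hK : IsCompact K)
    (hP : ∀ y ∈ K, ∀ᶠ q : ι × X in l ×ˢ 𝓝 y, P q.1 q.2) : ∀ᶠ n in l, ∀ y ∈ K, P n y := by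
  obtain ⟨p, hp, r, hr, hpr⟩ := eventually_prod_iff.1 (hK.mem_prod_nhdsSet_of_forall hP)
  exact hp.mono fun n hn y hy => hpr hn (hr.self_of_nhdsSet y hy)

namespace OrientedComponent

variable {a b c d p σ : ℝ} {f : ℝ → ℝ}

theorem exists_isGreatest (h : OrientedComponent a b f c d p σ) (hab : a < b)
    (hf : IsC2Diffeo a b f) (hpar : OnlyParabolicFixedPoints a b f) :
    ∃ M, IsGreatest ((fun y => |field a b f c d p σ y|) '' Icc c d) M :=
  (isCompact_Icc.image_of_continuousOn (h.continuousOn_field hab hf hpar).abs).exists_isGreatest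
    ((nonempty_Icc.2 h.isComponent.lt.le).image _)

theorem mem_growthValues (h : OrientedComponent a b f c d p σ) (hab : a < b)
    (hf : IsC2Diffeo a b f) (hpar : OnlyParabolicFixedPoints a b f) {M : ℝ}
    (hM : IsGreatest ((fun y => |field a b f c d p σ y|) '' Icc c d) M) :
    1 / 2 * |secondDeriv a b f p| * M ∈ growthValues a b f :=
  ⟨c, d, p, field a b f c d p σ, M, h.isComponent, h.isRepellingEndpoint,
    h.isSzekeresField_field hab hf hpar, h.continuousOn_field hab hf hpar, hM, rfl⟩

theorem exists_le_growthValue (h : OrientedComponent a b f c d p σ) (hab : a < b)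
    (hf : IsC2Diffeo a b f) (hpar : OnlyParabolicFixedPoints a b f) {x : ℝ} (hx : x ∈ Icc c d) :
    ∃ v ∈ growthValues a b f, 1 / 2 * |secondDeriv a b f p| * |field a b f c d p σ x| ≤ v := by
  obtain ⟨M, hM⟩ := h.exists_isGreatest hab hf hpar
  exact ⟨_, h.mem_growthValues hab hf hpar hM,
    mul_le_mul_of_nonneg_left (hM.2 ⟨x, hx, rfl⟩) (by positivity)⟩

theorem abs_secondDeriv_inverse (h : OrientedComponent a b f c d p σ) (hab : a < b)
    (hf : IsC2Diffeo a b f) (hpar : OnlyParabolicFixedPoints a b f) :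
    |secondDeriv a b (inverse a b f) p| = |secondDeriv a b f p| := by
  rw [hf.secondDeriv_inverse_of_fixed hab hpar h.mem_Icc h.fixed, abs_neg]

theorem tendsto_inv_iterDeriv_div_sq (h : OrientedComponent a b f c d p σ) (hab : a < b)
    (hf : IsC2Diffeo a b f) (hpar : OnlyParabolicFixedPoints a b f) {y : ℝ} (hy : y ∈ Ioo c d) :
    Tendsto (fun q : ℕ × ℝ => (iterDeriv (inverse a b f)
        (derivWithin (inverse a b f) (Icc a b)) q.1 q.2)⁻¹ / (q.1 : ℝ) ^ 2) (atTop ×ˢ 𝓝 y)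
      (𝓝 (1 / 2 * |secondDeriv a b f p| * |field a b f c d p σ y|)) := by
  obtain ⟨C, hC⟩ := hf.symm.exists_isDistortionBound hab
  have hg := h.parabolicContraction hab hf hpar hC
  have hcoeff : -(σ * secondDeriv a b (inverse a b f) (p + σ * 0)) / 2 =
      1 / 2 * |secondDeriv a b f p| := by
    rw [← abs_of_nonpos hg.deriv₂_zero_nonpos, abs_mul, h.abs_eq_one, mul_zero, add_zero,
      h.abs_secondDeriv_inverse hab hf hpar]
    ring
  have hlim := hg.tendsto_inv_iterDeriv_div_sq (h.mul_sub_mem_Ioo_iff.2 hy)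
  rw [hcoeff, ← h.abs_field] at hlim
  have hcoord : Tendsto (fun x : ℝ => σ * (x - p)) (𝓝 y) (𝓝 (σ * (y - p))) :=
    Continuous.tendsto (by fun_prop) y
  refine (hlim.comp (tendsto_id.prodMap hcoord)).congr fun q => ?_
  simp only [Function.comp_apply, Prod.map, id]
  rw [← iterDeriv_add_mul h.mul_self, add_mul_mul_sub h.mul_self]

theorem inv_iterDeriv_le (h : OrientedComponent a b f c d p σ) (hab : a < b)
    (hf : IsC2Diffeo a b f) (hpar : OnlyParabolicFixedPoints a b f) {C : ℝ}
    (hC : IsDistortionBound a b (inverse a b f) C) {y : ℝ} (hy : y ∈ Ioo c d) (n : ℕ) :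
    (iterDeriv (inverse a b f) (derivWithin (inverse a b f) (Icc a b)) n y)⁻¹ ≤
      2 * Real.exp (C ^ 2) ^ 2 *
        (1 + ((2 + C) * C) ^ 2 * (n ^ 2 * |disp (inverse a b f) y|)) := by
  have hg := h.parabolicContraction hab hf hpar hC
  have hs := h.mul_sub_mem_Ioo_iff.2 hy
  have hle := hg.inv_iterDeriv_le hs n
  rwa [← iterDeriv_add_mul h.mul_self, ← abs_of_pos (hg.disp_pos hs), disp_chart h.mul_self,
    add_mul_mul_sub h.mul_self, abs_mul, h.abs_eq_one, one_mul] at hle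

theorem abs_field_le (h : OrientedComponent a b f c d p σ) (hab : a < b)
    (hf : IsC2Diffeo a b f) (hpar : OnlyParabolicFixedPoints a b f) {C : ℝ}
    (hC : IsDistortionBound a b (inverse a b f) C) (x : ℝ) :
    |field a b f c d p σ x| ≤ Real.exp (C ^ 2) * C := by
  have hg := h.parabolicContraction hab hf hpar hC
  by_cases hx : x ∈ Ioo c d
  · have hs := h.mul_sub_mem_Ioo_iff.2 hx
    rw [h.abs_field]
    refine (hg.szekeres_le hs).trans (mul_le_mul_of_nonneg_left ?_ (Real.exp_pos _).le)
    exact (hg.disp_le_self hs).trans (hs.2.le.trans hg.le)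
  · rw [h.field_eq_zero hx, abs_zero]
    exact mul_nonneg (Real.exp_pos _).le hg.const_pos.le

end OrientedComponent

namespace IsC2Diffeo

variable {a b x y : ℝ} {f : ℝ → ℝ}

theorem exists_orientedComponent (hf : IsC2Diffeo a b f) (hx : x ∈ Icc a b) (hfx : f x ≠ x) :
    ∃ c d p σ, OrientedComponent a b f c d p σ ∧ x ∈ Ioo c d := by
  obtain ⟨c, d, hI, hxI⟩ := hf.exists_isComponent hx hfx
  obtain ⟨p, σ, ho⟩ := hI.exists_orientedComponent hf
  exact ⟨c, d, p, σ, ho, hxI⟩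

theorem mem_growthValues_iff (hf : IsC2Diffeo a b f) (hab : a < b)
    (hpar : OnlyParabolicFixedPoints a b f) {v : ℝ} :
    v ∈ growthValues a b f ↔ ∃ c d p σ M, OrientedComponent a b f c d p σ ∧
      IsGreatest ((fun y => |OrientedComponent.field a b f c d p σ y|) '' Icc c d) M ∧
      v = 1 / 2 * |secondDeriv a b f p| * M := by
  constructor
  · rintro ⟨c, d, r, X, M, hI, hr, hX, hXc, hM, rfl⟩
    obtain ⟨p, σ, ho⟩ := hI.exists_orientedComponent hf
    obtain rfl := ho.eq_of_isRepellingEndpoint hf hr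
    refine ⟨c, d, r, σ, M, ho, ?_, rfl⟩
    rwa [image_congr fun y hy => by rw [ho.eqOn_field_Icc hab hf hpar hX hXc hy]] at hM
  · rintro ⟨c, d, p, σ, M, ho, hM, rfl⟩
    exact ho.mem_growthValues hab hf hpar hM

theorem nonempty_growthValues (hf : IsC2Diffeo a b f) (hab : a < b)
    (hpar : OnlyParabolicFixedPoints a b f) (hne : ∃ x ∈ Icc a b, f x ≠ x) :
    (growthValues a b f).Nonempty := by
  obtain ⟨x, hx, hfx⟩ := hne
  obtain ⟨c, d, p, σ, ho, -⟩ := hf.exists_orientedComponent hx hfx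
  obtain ⟨M, hM⟩ := ho.exists_isGreatest hab hf hpar
  exact ⟨_, ho.mem_growthValues hab hf hpar hM⟩

theorem bddAbove_growthValues (hf : IsC2Diffeo a b f) (hab : a < b)
    (hpar : OnlyParabolicFixedPoints a b f) : BddAbove (growthValues a b f) := by
  obtain ⟨C, hC⟩ := hf.symm.exists_isDistortionBound hab
  have hC₀ : 0 ≤ C := (sub_pos.2 hab).le.trans hC.sub_le
  refine ⟨1 / 2 * C * (Real.exp (C ^ 2) * C), fun v hv => ?_⟩
  obtain ⟨c, d, p, σ, M, ho, ⟨⟨y, -, rfl⟩, -⟩, rfl⟩ := (hf.mem_growthValues_iff hab hpar).1 hv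
  have hfield := ho.abs_field_le hab hf hpar hC y
  have hderiv := hC.abs_secondDeriv_le p ho.mem_Icc
  rw [ho.abs_secondDeriv_inverse hab hf hpar] at hderiv
  gcongr

theorem iterDeriv_inverse_of_fixed (hf : IsC2Diffeo a b f) (hab : a < b)
    (hpar : OnlyParabolicFixedPoints a b f) (hy : y ∈ Icc a b) (hfy : f y = y) (n : ℕ) :
    iterDeriv (inverse a b f) (derivWithin (inverse a b f) (Icc a b)) n y = 1 := by
  have hfix := (hf.inverse_eq_self_iff hy).2 hfy
  refine Finset.prod_eq_one fun i _ => ?_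
  rw [Function.iterate_fixed hfix]
  exact hf.onlyParabolicFixedPoints_inverse hab hpar y hy hfix

theorem exists_inv_iterDeriv_le (hf : IsC2Diffeo a b f) (hab : a < b)
    (hpar : OnlyParabolicFixedPoints a b f) :
    ∃ K, 0 < K ∧ ∀ y ∈ Icc a b, ∀ n : ℕ,
      (iterDeriv (inverse a b f) (derivWithin (inverse a b f) (Icc a b)) n y)⁻¹ ≤
        K * (1 + n ^ 2 * |disp (inverse a b f) y|) := by
  obtain ⟨C, hC⟩ := hf.symm.exists_isDistortionBound hab
  set A := 2 * Real.exp (C ^ 2) ^ 2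
  set B := ((2 + C) * C) ^ 2
  have : 0 < A := by positivity
  have : 0 ≤ B := sq_nonneg _
  refine ⟨A * (1 + B) + 1, by positivity, fun y hy n => ?_⟩
  set t := (n : ℝ) ^ 2 * |disp (inverse a b f) y|
  have ht : 0 ≤ t := by positivity
  by_cases hfy : f y = y
  · rw [hf.iterDeriv_inverse_of_fixed hab hpar hy hfy, inv_one]
    exact one_le_mul_of_one_le_of_one_le (le_add_of_nonneg_left (by positivity))
      (le_add_of_nonneg_right ht)
  · obtain ⟨c, d, p, σ, ho, hyI⟩ := hf.exists_orientedComponent hy hfy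
    calc _ ≤ A * (1 + B * t) := ho.inv_iterDeriv_le hab hf hpar hC hyI n
      _ ≤ A * (1 + B * t) + (A * (B + t) + (1 + t)) := le_add_of_nonneg_right (by positivity)
      _ = (A * (1 + B) + 1) * (1 + t) := by ring

theorem eventually_inv_iterDeriv_div_sq_le_of_le_disp (hf : IsC2Diffeo a b f) (hab : a < b)
    (hpar : OnlyParabolicFixedPoints a b f) {l u η : ℝ}
    (hl : l ∈ upperBounds (growthValues a b f)) (hlu : l < u) (hη : 0 < η) :
    ∀ᶠ n : ℕ in atTop, ∀ y ∈ {y ∈ Icc a b | η ≤ |disp (inverse a b f) y|},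
      (iterDeriv (inverse a b f) (derivWithin (inverse a b f) (Icc a b)) n y)⁻¹ /
        (n : ℝ) ^ 2 ≤ u := by
  have hdisp : ContinuousOn (fun y => |disp (inverse a b f) y|) (Icc a b) :=
    (continuousOn_id.sub hf.contDiffOn_inverse.continuousOn).abs
  have hcompact : IsCompact {y ∈ Icc a b | η ≤ |disp (inverse a b f) y|} :=
    isCompact_Icc.of_isClosed_subset
      (hdisp.preimage_isClosed_of_isClosed isClosed_Icc isClosed_Ici) (sep_subset _ _)
  refine eventually_forall_mem_of_isCompact hcompact fun y ⟨hy, hyη⟩ => ?_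
  have hfy : f y ≠ y := fun hfix => by
    rw [disp, (hf.inverse_eq_self_iff hy).2 hfix, sub_self, abs_zero] at hyη
    exact hη.not_ge hyη
  obtain ⟨c, d, p, σ, ho, hyI⟩ := hf.exists_orientedComponent hy hfy
  obtain ⟨v, hv, hle⟩ := ho.exists_le_growthValue hab hf hpar (Ioo_subset_Icc_self hyI)
  exact ((ho.tendsto_inv_iterDeriv_div_sq hab hf hpar hyI).eventually
    (gt_mem_nhds ((hle.trans (hl hv)).trans_lt hlu))).mono fun q => le_of_lt

theorem eventually_inv_iterDeriv_div_sq_le (hf : IsC2Diffeo a b f) (hab : a < b)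
    (hpar : OnlyParabolicFixedPoints a b f) {l u : ℝ}
    (hl : l ∈ upperBounds (growthValues a b f)) (hl₀ : 0 ≤ l) (hlu : l < u) :
    ∀ᶠ n : ℕ in atTop, ∀ y ∈ Icc a b,
      (iterDeriv (inverse a b f) (derivWithin (inverse a b f) (Icc a b)) n y)⁻¹ /
        (n : ℝ) ^ 2 ≤ u := by
  obtain ⟨K, hK, hbound⟩ := hf.exists_inv_iterDeriv_le hab hpar
  have hu : 0 < u := hl₀.trans_lt hlu
  have hlarge : ∀ᶠ n : ℕ in atTop, 2 * K / u < (n : ℝ) ^ 2 :=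
    ((tendsto_pow_atTop two_ne_zero).comp
      (tendsto_natCast_atTop_atTop (R := ℝ))).eventually_gt_atTop _
  filter_upwards [hf.eventually_inv_iterDeriv_div_sq_le_of_le_disp hab hpar hl hlu
    (show 0 < u / (2 * K) by positivity), hlarge] with n hfar hn y hy
  rcases le_or_gt (u / (2 * K)) |disp (inverse a b f) y| with hdisp | hdisp
  · exact hfar y ⟨hy, hdisp⟩
  have hn₀ : 0 < (n : ℝ) ^ 2 := lt_trans (by positivity) hn
  rw [div_le_iff₀ hn₀]
  calc _ ≤ K * (1 + n ^ 2 * |disp (inverse a b f) y|) := hbound y hy n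
    _ ≤ K * (1 + n ^ 2 * (u / (2 * K))) := by gcongr
    _ = K + u / 2 * n ^ 2 := by field_simp
    _ ≤ u * n ^ 2 := by linarith [(div_lt_iff₀ hu).1 hn]

theorem derivWithin_iterate_le_gammaPlus (hf : IsC2Diffeo a b f) (hab : a < b)
    (hx : x ∈ Icc a b) (n : ℕ) : derivWithin (f^[n]) (Icc a b) x ≤ gammaPlus a b f n :=
  le_csSup (isCompact_Icc.bddAbove_image (hf.continuousOn_derivWithin_iterate hab n)) ⟨x, hx, rfl⟩

theorem gammaPlus_le (hab : a ≤ b) {n : ℕ} {K : ℝ}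
    (hK : ∀ x ∈ Icc a b, derivWithin (f^[n]) (Icc a b) x ≤ K) : gammaPlus a b f n ≤ K :=
  csSup_le ((nonempty_Icc.2 hab).image _) (forall_mem_image.2 hK)

theorem inv_iterDeriv_le_gammaPlus (hf : IsC2Diffeo a b f) (hab : a < b) (hy : y ∈ Icc a b)
    (n : ℕ) :
    (iterDeriv (inverse a b f) (derivWithin (inverse a b f) (Icc a b)) n y)⁻¹ ≤
      gammaPlus a b f n := by
  have hx := hf.symm.iterate_mem hy n
  have hle := hf.derivWithin_iterate_le_gammaPlus hab hx n
  rwa [hf.derivWithin_iterate_eq_inv hab hx, hf.iterate_inverse_iterate hy] at hle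

theorem gammaPlus_nonneg (hf : IsC2Diffeo a b f) (hab : a < b) (n : ℕ) :
    0 ≤ gammaPlus a b f n := by
  refine Real.sSup_nonneg (forall_mem_image.2 fun x hx => ?_)
  rw [hf.derivWithin_iterate hab hx]
  exact Finset.prod_nonneg fun i _ => (hf.derivWithin_pos hab (hf.iterate_mem hx i)).le

theorem eventually_lt_gammaPlus_div_sq (hf : IsC2Diffeo a b f) (hab : a < b)
    (hpar : OnlyParabolicFixedPoints a b f) {u v : ℝ} (hv : v ∈ growthValues a b f)
    (huv : u < v) : ∀ᶠ n : ℕ in atTop, u < gammaPlus a b f n / (n : ℝ) ^ 2 := by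
  obtain ⟨c, d, p, σ, M, ho, ⟨⟨y, hy, rfl⟩, -⟩, rfl⟩ := (hf.mem_growthValues_iff hab hpar).1 hv
  by_cases hyI : y ∈ Ioo c d
  · have hlim := (ho.tendsto_inv_iterDeriv_div_sq hab hf hpar hyI).comp
      (tendsto_id.prodMk (tendsto_const_nhds (x := y)))
    filter_upwards [hlim.eventually (lt_mem_nhds huv)] with n hn
    exact hn.trans_le (div_le_div_of_nonneg_right
      (hf.inv_iterDeriv_le_gammaPlus hab (ho.isComponent.subset hy) n) (sq_nonneg _))
  · simp only [ho.field_eq_zero hyI, abs_zero, mul_zero] at huv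
    exact Eventually.of_forall fun n =>
      huv.trans_le (div_nonneg (hf.gammaPlus_nonneg hab n) (sq_nonneg _))

theorem tendsto_gammaPlus (hf : IsC2Diffeo a b f) (hab : a < b)
    (hpar : OnlyParabolicFixedPoints a b f) {l : ℝ} (hl : IsLUB (growthValues a b f) l)
    (hl₀ : 0 ≤ l) :
    Tendsto (fun n : ℕ => gammaPlus a b f n / (n : ℝ) ^ 2) atTop (𝓝 l) := by
  refine tendsto_order.2 ⟨fun u hu => ?_, fun u hu => ?_⟩
  · obtain ⟨v, hv, huv⟩ := (lt_isLUB_iff hl).1 hu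
    exact hf.eventually_lt_gammaPlus_div_sq hab hpar hv huv
  · obtain ⟨w, hlw, hwu⟩ := exists_between hu
    filter_upwards [hf.eventually_inv_iterDeriv_div_sq_le hab hpar hl.1 hl₀ hlw,
      eventually_gt_atTop 0] with n hle hn
    refine lt_of_le_of_lt ?_ hwu
    rw [div_le_iff₀ (by positivity)]
    refine gammaPlus_le hab.le fun x hx => ?_
    rw [hf.derivWithin_iterate_eq_inv hab hx, ← div_le_iff₀ (by positivity)]
    exact hle _ (hf.iterate_mem hx n)

end IsC2Diffeo

theorem nonneg_of_mem_growthValues {a b v : ℝ} {f : ℝ → ℝ} (hv : v ∈ growthValues a b f) :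
    0 ≤ v := by
  obtain ⟨c, d, r, X, M, -, -, -, -, ⟨⟨y, -, rfl⟩, -⟩, rfl⟩ := hv
  positivity

namespace IsC2Diffeo

variable {a b : ℝ} {f : ℝ → ℝ}

theorem exists_pos_mem_growthValues (hf : IsC2Diffeo a b f) (hab : a < b)
    (hpar : OnlyParabolicFixedPoints a b f) {c d r : ℝ} (hI : IsComponent a b f c d)
    (hr : IsRepellingEndpoint f c d r) (hr₂ : secondDeriv a b f r ≠ 0) :
    ∃ v ∈ growthValues a b f, 0 < v := by
  obtain ⟨p, σ, ho⟩ := hI.exists_orientedComponent hf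
  obtain rfl := ho.eq_of_isRepellingEndpoint hf hr
  obtain ⟨x, hx⟩ := nonempty_Ioo.2 hI.lt
  obtain ⟨v, hv, hle⟩ := ho.exists_le_growthValue hab hf hpar (Ioo_subset_Icc_self hx)
  have : 0 < |OrientedComponent.field a b f c d r σ x| := abs_pos.2 (ho.field_ne_zero hx)
  exact ⟨v, hv, lt_of_lt_of_le (by positivity) hle⟩

theorem exists_tendsto_gammaPlus (hf : IsC2Diffeo a b f) (hab : a < b)
    (hpar : OnlyParabolicFixedPoints a b f) (hne : ∃ x ∈ Icc a b, f x ≠ x) :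
    ∃ l : ℝ,
      Tendsto (fun n : ℕ => gammaPlus a b f n / (n : ℝ) ^ 2) atTop (𝓝 l) ∧
      IsLUB (growthValues a b f) l ∧
      ((∃ c d r : ℝ, IsComponent a b f c d ∧ IsRepellingEndpoint f c d r ∧
          secondDeriv a b f r ≠ 0) → 0 < l) ∧
      ((∀ c d r : ℝ, IsComponent a b f c d → IsRepellingEndpoint f c d r →
          secondDeriv a b f r = 0) → l = 0) := by
  obtain ⟨v₀, hv₀⟩ := hf.nonempty_growthValues hab hpar hne
  have hl := isLUB_csSup ⟨v₀, hv₀⟩ (hf.bddAbove_growthValues hab hpar)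
  have hl₀ := (nonneg_of_mem_growthValues hv₀).trans (hl.1 hv₀)
  refine ⟨_, hf.tendsto_gammaPlus hab hpar hl hl₀, hl, ?_, fun hzero => ?_⟩
  · rintro ⟨c, d, r, hI, hr, hr₂⟩
    obtain ⟨v, hv, hpos⟩ := hf.exists_pos_mem_growthValues hab hpar hI hr hr₂
    exact hpos.trans_le (hl.1 hv)
  · refine le_antisymm (hl.2 ?_) hl₀
    rintro v ⟨c, d, r, X, M, hI, hr, -, -, -, rfl⟩
    rw [hzero c d r hI hr, abs_zero, mul_zero, zero_mul]

theorem gamma_eq_max (hf : IsC2Diffeo a b f) (hab : a < b) (n : ℕ) :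
    gamma a b f n = max (gammaPlus a b f n) (gammaPlus a b (inverse a b f) n) := by
  have hle : ∀ x ∈ Icc a b, max (derivWithin (f^[n]) (Icc a b) x)
      (derivWithin ((inverse a b f)^[n]) (Icc a b) x) ≤
        max (gammaPlus a b f n) (gammaPlus a b (inverse a b f) n) := fun x hx =>
    max_le_max (hf.derivWithin_iterate_le_gammaPlus hab hx n)
      (hf.symm.derivWithin_iterate_le_gammaPlus hab hx n)
  have hge : ∀ x ∈ Icc a b, max (derivWithin (f^[n]) (Icc a b) x)
      (derivWithin ((inverse a b f)^[n]) (Icc a b) x) ≤ gamma a b f n := fun x hx =>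
    le_csSup ⟨_, forall_mem_image.2 hle⟩ ⟨x, hx, rfl⟩
  exact le_antisymm
    (csSup_le ((nonempty_Icc.2 hab.le).image _) (forall_mem_image.2 hle))
    (max_le (gammaPlus_le hab.le fun x hx => (le_max_left _ _).trans (hge x hx))
      (gammaPlus_le hab.le fun x hx => (le_max_right _ _).trans (hge x hx)))

theorem exists_tendsto_gamma (hf : IsC2Diffeo a b f) (hab : a < b)
    (hpar : OnlyParabolicFixedPoints a b f) (hne : ∃ x ∈ Icc a b, f x ≠ x) :
    ∃ l : ℝ, Tendsto (fun n : ℕ => gamma a b f n / (n : ℝ) ^ 2) atTop (𝓝 l) ∧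
      ((∀ x ∈ Icc a b, f x = x → secondDeriv a b f x = 0) → l = 0) := by
  obtain ⟨l, htendsto, -, -, hl⟩ := hf.exists_tendsto_gammaPlus hab hpar hne
  obtain ⟨l', htendsto', -, -, hl'⟩ := hf.symm.exists_tendsto_gammaPlus hab
    (hf.onlyParabolicFixedPoints_inverse hab hpar)
    (hne.imp fun x ⟨hx, hfx⟩ => ⟨hx, mt (hf.inverse_eq_self_iff hx).1 hfx⟩)
  refine ⟨max l l', (htendsto.max htendsto').congr fun n => ?_, fun hzero => ?_⟩
  · rw [hf.gamma_eq_max hab, max_div_div_right (sq_nonneg _)]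
  have hl_zero : l = 0 := hl fun c d r hI hr => hzero r (hr.mem_Icc hI) (hr.fixed hI)
  have hl_zero' : l' = 0 := hl' fun c d r hI hr => by
    have hmem := hr.mem_Icc hI
    have hfix := (hf.inverse_eq_self_iff hmem).1 (hr.fixed hI)
    rw [hf.secondDeriv_inverse_of_fixed hab hpar hmem hfix, hzero r hmem hfix, neg_zero]
  rw [hl_zero, hl_zero', max_self]

end IsC2Diffeo

end IntervalDiffeo

theorem mainTheorem1 (a b : ℝ) (hab : a < b) (f : ℝ → ℝ)
    (hf : IntervalDiffeo.IsC2Diffeo a b f)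
    (hpar : IntervalDiffeo.OnlyParabolicFixedPoints a b f)
    (hne : ∃ x ∈ Icc a b, f x ≠ x) :
    -- on each component, the repelling endpoint and the Szekeres vector field are well defined,
    -- and the latter extends continuously to the closed component
    (∀ c d : ℝ, IntervalDiffeo.IsComponent a b f c d →
      (∃! r : ℝ, IntervalDiffeo.IsRepellingEndpoint f c d r) ∧
      ∀ r : ℝ, IntervalDiffeo.IsRepellingEndpoint f c d r →
        ∃ X : ℝ → ℝ, IntervalDiffeo.IsSzekeresField f c d r X ∧ ContinuousOn X (Icc c d) ∧
          ∀ Y : ℝ → ℝ, IntervalDiffeo.IsSzekeresField f c d r Y →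
            EqOn Y X (IntervalDiffeo.halfClosed c d r)) ∧
    -- the limit, its value, and when it vanishes
    (∃ ℓ : ℝ,
      Tendsto (fun n : ℕ => IntervalDiffeo.gammaPlus a b f n / (n : ℝ) ^ 2) atTop (𝓝 ℓ) ∧
      IsLUB (IntervalDiffeo.growthValues a b f) ℓ ∧
      ((∃ c d r : ℝ, IntervalDiffeo.IsComponent a b f c d ∧
          IntervalDiffeo.IsRepellingEndpoint f c d r ∧
          IntervalDiffeo.secondDeriv a b f r ≠ 0) → 0 < ℓ) ∧
      ((∀ c d r : ℝ, IntervalDiffeo.IsComponent a b f c d →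
          IntervalDiffeo.IsRepellingEndpoint f c d r →
          IntervalDiffeo.secondDeriv a b f r = 0) → ℓ = 0)) ∧
    -- iterates of both signs
    (∃ ℓ' : ℝ,
      Tendsto (fun n : ℕ => IntervalDiffeo.gamma a b f n / (n : ℝ) ^ 2) atTop (𝓝 ℓ') ∧
      ((∀ x ∈ Icc a b, f x = x → IntervalDiffeo.secondDeriv a b f x = 0) → ℓ' = 0)) := by
  refine ⟨fun c d hI => ?_, hf.exists_tendsto_gammaPlus hab hpar hne,
    hf.exists_tendsto_gamma hab hpar hne⟩
  obtain ⟨p, σ, ho⟩ := hI.exists_orientedComponent hf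
  refine ⟨⟨p, ho.isRepellingEndpoint, fun r hr => ho.eq_of_isRepellingEndpoint hf hr⟩,
    fun r hr => ?_⟩
  obtain rfl := ho.eq_of_isRepellingEndpoint hf hr
  exact ⟨_, ho.isSzekeresField_field hab hf hpar, ho.continuousOn_field hab hf hpar,
    fun Y hY => ho.eqOn_field hab hf hpar hY⟩
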